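/- Let $\ell>0$, let $U:L^2([0,\ell])\to L^2(\mathbb R)$ be the isometry extending functions by zero, and let $\mathcal F$ be the Fourier–Plancherel operator on $L^2(\mathbb R)$, $(\mathcal F\psi)(x)=\frac1{\sqrt{2\pi}}\int_{\mathbb R}e^{-ixt}\psi(t)\,dt$ for $\psi\in L^1\cap L^2$. For Borel sets $Y\subseteq\mathbb R$ let $\mathsf P_{\mathbb R}(Y)=\mathcal F^*\,\mathsf Q_{\mathbb R}(Y)\,\mathcal F$, where $\mathsf Q_{\mathbb R}(Y)$ is multiplication by the characteristic function of $Y$, and let $\mathsf P(Y)=U^*\mathsf P_{\mathbb R}(Y)U$, a positive operator measure on $L^2([0,\ell])$. For $n\in\mathbb N$ let $\mathsf P[n]$ be the maximal strong operator integral of $x\mapsto x^n$: its domain is the set of all $\varphi\in L^2([0,\ell])$ such that $x^n$ is integrable with respect to the $L^2([0,\ell])$-valued vector measure $Y\mapsto\mathsf P(Y)\varphi$, and $\mathsf P[n]\varphi=\int x^n\,d\mathsf P(x)\varphi$. Here a measurable function $f$ is integrable with respect to a vector measure $\mu$ if there are simple functions $f_k\to f$ pointwise such that $\lim_k\int_X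 f_k\,d\mu$ exists for every measurable $X$; then $\int f\,d\mu=\lim_k\int f_k\,d\mu$. Let $\tilde{\mathsf P}[n]$ be the restriction of $\mathsf P[n]$ to the square integrability domain $\{\varphi : \int x^{2n}\,d\langle\varphi|\mathsf P(x)\varphi\rangle<\infty\}$. Let $P_0=-i\,\frac{d}{dx}$ be the operator in $L^2([0,\ell])$ whose domain consists of the absolutely continuous functions $\varphi$ on $[0,\ell]$ with $\varphi'\in L^2([0,\ell])$ and $\varphi(0)=\varphi(\ell)=0$, and let $P_0^n$ be its $n$-th power on its natural domain. Then, for every $n=1,2,\dots$, $$\mathsf P[n]=\tilde{\mathsf P}[n]=P_0^n$$ as unbounded operators (equality of domains and of values). -/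

import Mathlib

open MeasureTheory Filter Topology
open scoped ENNReal InnerProductSpace FourierTransform

noncomputable section

namespace MomentumMoments

/-! ### Positive operator measures and their strong operator integrals -/

section POVM

variable {Ω : Type*} [MeasurableSpace Ω]
variable {H : Type*} [NormedAddCommGroup H] [InnerProductSpace ℂ H] [CompleteSpace H]
variable {K : Type*} [NormedAddCommGroup K] [InnerProductSpace ℂ K] [CompleteSpace K]

/-- A positive operator (valued) measure: a strongly σ-additive map from the measurable sets into
the positive bounded operators (the values at non-measurable sets are irrelevant). -/
structure POVM (Ω : Type*) [MeasurableSpace Ω] (H : Type*) [NormedAddCommGroup H]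
    [InnerProductSpace ℂ H] [CompleteSpace H] where
  op : Set Ω → H →L[ℂ] H
  isPositive : ∀ X, MeasurableSet X → (op X).IsPositive
  hasSum_iUnion : ∀ X : ℕ → Set Ω, (∀ i, MeasurableSet (X i)) →
    Pairwise (Function.onFun Disjoint X) →
    ∀ φ : H, HasSum (fun i => op (X i) φ) (op (⋃ i, X i) φ)

lemma POVM.op_empty (E : POVM Ω H) (φ : H) : E.op ∅ φ = 0 := by
  have h := E.hasSum_iUnion (fun _ => ∅) (fun _ => MeasurableSet.empty)
    (fun _ _ _ => by simp [Function.onFun]) φ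
  have h2 := h.summable.tendsto_atTop_zero
  exact tendsto_nhds_unique tendsto_const_nhds h2

open Classical in
/-- The vector measure `X ↦ E(X) φ`. -/
def POVM.vectorMeasure (E : POVM Ω H) (φ : H) : VectorMeasure Ω H where
  measureOf' X := if MeasurableSet X then E.op X φ else 0
  empty' := by simp [E.op_empty]
  not_measurable' X hX := by simp [hX]
  m_iUnion' X hX hd := by
    have h := E.hasSum_iUnion X hX hd φ
    simpa [hX, MeasurableSet.iUnion hX] using h

/-- The finite positive measure `X ↦ ⟨φ, E(X) φ⟩`. -/
def POVM.diagMeasure (E : POVM Ω H) (φ : H) : Measure Ω :=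
  Measure.ofMeasurable (fun X _ => ENNReal.ofReal (RCLike.re ⟪φ, E.op X φ⟫_ℂ))
    (by simp [E.op_empty])
    (by
      intro X hX hd
      have h0 : ∀ i, 0 ≤ RCLike.re ⟪φ, E.op (X i) φ⟫_ℂ := fun i =>
        (E.isPositive _ (hX i)).re_inner_nonneg_right φ
      have h : HasSum (fun i => RCLike.re ⟪φ, E.op (X i) φ⟫_ℂ)
          (RCLike.re ⟪φ, E.op (⋃ i, X i) φ⟫_ℂ) :=
        ((RCLike.reCLM (K := ℂ)).comp (innerSL ℂ φ |>.restrictScalars ℝ)).hasSum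
          (E.hasSum_iUnion X hX hd φ)
      rw [← h.tsum_eq, ENNReal.ofReal_tsum_of_nonneg h0 h.summable])

/-- The integral over `X` of the simple function `g` with respect to the vector measure `μ`. -/
def simpleIntegral (μ : VectorMeasure Ω H) (g : SimpleFunc Ω ℂ) (X : Set Ω) : H :=
  ∑ y ∈ g.range, y • μ (g ⁻¹' {y} ∩ X)

/-- `f` is integrable with respect to the vector measure `μ`, with integral `v`: there are simple
functions `gₖ` converging pointwise to `f` such that the integrals of `gₖ` over `X` converge
for every measurable set `X`, and the integrals over the whole space converge to `v`. -/
def HasVectorIntegral (μ : VectorMeasure Ω H) (f : Ω → ℂ) (v : H) : Prop :=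
  ∃ g : ℕ → SimpleFunc Ω ℂ,
    (∀ x, Tendsto (fun k => g k x) atTop (𝓝 (f x))) ∧
    (∀ X, MeasurableSet X → ∃ w, Tendsto (fun k => simpleIntegral μ (g k) X) atTop (𝓝 w)) ∧
    Tendsto (fun k => simpleIntegral μ (g k) Set.univ) atTop (𝓝 v)

/-- The graph of the maximal strong operator integral `L(f, E)`: its domain consists of all `φ`
such that `f` is integrable with respect to `X ↦ E(X) φ`, and `φ` is mapped to that integral. -/
def POVM.strongIntegral (E : POVM Ω H) (f : Ω → ℂ) : Set (H × H) :=
  {p | HasVectorIntegral (E.vectorMeasure p.1) f p.2}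

/-- The square integrability domain: all `φ` such that `|f|²` is integrable with respect to
`X ↦ ⟨φ, E(X) φ⟩`. -/
def POVM.sqDomain (E : POVM Ω H) (f : Ω → ℂ) : Set H :=
  {φ | Integrable (fun x => ‖f x‖ ^ 2) (E.diagMeasure φ)}

/-- The graph of the restriction of `L(f, E)` to the square integrability domain. -/
def POVM.sqStrongIntegral (E : POVM Ω H) (f : Ω → ℂ) : Set (H × H) :=
  {p | p.1 ∈ E.sqDomain f ∧ HasVectorIntegral (E.vectorMeasure p.1) f p.2}

/-- The POVM `X ↦ V* F(X) V`. -/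
def POVM.compress (F : POVM Ω K) (V : H →L[ℂ] K) : POVM Ω H where
  op X := (ContinuousLinearMap.adjoint V) ∘L (F.op X) ∘L V
  isPositive X hX := (F.isPositive X hX).adjoint_conj V
  hasSum_iUnion X hX hd φ := by
    simpa using (ContinuousLinearMap.adjoint V).hasSum (F.hasSum_iUnion X hX hd (V φ))

/-- The graph of the maximal strong moment operator `E[n]`. -/
def POVM.moment (E : POVM ℝ H) (n : ℕ) : Set (H × H) :=
  E.strongIntegral (fun x => (x : ℂ) ^ n)

/-- The graph of the square integrability moment operator `Ẽ[n]`. -/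
def POVM.sqMoment (E : POVM ℝ H) (n : ℕ) : Set (H × H) :=
  E.sqStrongIntegral (fun x => (x : ℂ) ^ n)

end POVM

/-! ### Products and powers of unbounded operators -/

section Powers

variable {H : Type*} [AddCommGroup H] [Module ℂ H]

/-- The product `A B` on its natural domain `{x ∈ dom B | B x ∈ dom A}`. -/
def opMul (A B : H →ₗ.[ℂ] H) : H →ₗ.[ℂ] H :=
  A.comp (B.domRestrict ((A.domain.comap B.toFun).map B.domain.subtype)) (by
    rintro ⟨x, ⟨y, hy, rfl⟩, hx⟩
    exact hy)

/-- The powers of an unbounded operator on their natural domains. -/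
def opPow (A : H →ₗ.[ℂ] H) : ℕ → (H →ₗ.[ℂ] H)
  | 0 => LinearMap.id.toPMap ⊤
  | n + 1 => opMul A (opPow A n)

end Powers

/-! ### The position and momentum observables on the line -/

/-- The Hilbert space `L²(ℝ)`. -/
abbrev L2R : Type := Lp ℂ 2 (volume : Measure ℝ)

/-- The Hilbert space `L²([0, ℓ])`. -/
abbrev L2I (ℓ : ℝ) : Type := Lp ℂ 2 ((volume : Measure ℝ).restrict (Set.Icc 0 ℓ))

/-- Multiplication by the characteristic function of the measurable set `X` on `L²(ℝ)`. -/
def chiMul (X : Set ℝ) (hX : MeasurableSet X) : L2R →L[ℂ] L2R :=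
  LinearMap.mkContinuous
    { toFun := fun ψ => ((Lp.memLp ψ).indicator hX).toLp (X.indicator ψ)
      map_add' := fun ψ χ => by
        rw [← MemLp.toLp_add]
        apply MemLp.toLp_congr
        filter_upwards [Lp.coeFn_add ψ χ] with x hx
        by_cases h : x ∈ X
        · simp only [h, Set.indicator_of_mem, Pi.add_apply]
          exact hx
        · simp [h]
      map_smul' := fun c ψ => by
        rw [RingHom.id_apply, ← MemLp.toLp_const_smul]
        apply MemLp.toLp_congr
        filter_upwards [Lp.coeFn_smul c ψ] with x hx
        by_cases h : x ∈ X
        · simp only [h, Set.indicator_of_mem, Pi.smul_apply]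
          exact hx
        · simp [h] } 1
    (fun ψ => by
      rw [one_mul]
      simp only [LinearMap.coe_mk, AddHom.coe_mk, Lp.norm_toLp]
      rw [Lp.norm_def]
      exact ENNReal.toReal_mono (Lp.eLpNorm_ne_top ψ) (eLpNorm_indicator_le _))

lemma chiMul_apply (X : Set ℝ) (hX : MeasurableSet X) (ψ : L2R) :
    chiMul X hX ψ = ((Lp.memLp ψ).indicator hX).toLp (X.indicator ψ) :=
  rfl

lemma coeFn_chiMul (X : Set ℝ) (hX : MeasurableSet X) (ψ : L2R) :
    chiMul X hX ψ =ᵐ[volume] X.indicator ψ := by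
  rw [chiMul_apply]
  exact MemLp.coeFn_toLp _

lemma inner_chiMul_left (X : Set ℝ) (hX : MeasurableSet X) (ψ φ : L2R) :
    ⟪chiMul X hX ψ, φ⟫_ℂ = ∫ x in X, ⟪ψ x, φ x⟫_ℂ := by
  rw [L2.inner_def, ← integral_indicator hX]
  apply integral_congr_ae
  filter_upwards [coeFn_chiMul X hX ψ] with x hx
  by_cases h : x ∈ X <;> simp [h, hx]

lemma inner_chiMul_right (X : Set ℝ) (hX : MeasurableSet X) (ψ φ : L2R) :
    ⟪ψ, chiMul X hX φ⟫_ℂ = ∫ x in X, ⟪ψ x, φ x⟫_ℂ := by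
  rw [L2.inner_def, ← integral_indicator hX]
  apply integral_congr_ae
  filter_upwards [coeFn_chiMul X hX φ] with x hx
  by_cases h : x ∈ X <;> simp [h, hx]

lemma chiMul_isPositive (X : Set ℝ) (hX : MeasurableSet X) : (chiMul X hX).IsPositive := by
  refine ⟨fun ψ φ => ?_, fun ψ => ?_⟩
  · exact (inner_chiMul_left X hX ψ φ).trans (inner_chiMul_right X hX ψ φ).symm
  · rw [ContinuousLinearMap.reApplyInnerSelf_apply, inner_chiMul_left]
    have h : ∀ x, ⟪ψ x, ψ x⟫_ℂ = ((‖ψ x‖ ^ 2 : ℝ) : ℂ) := fun x => by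
      rw [inner_self_eq_norm_sq_to_K]; simp
    simp_rw [h]
    rw [integral_complex_ofReal]
    exact integral_nonneg fun x => by positivity

lemma norm_chiMul_sq (X : Set ℝ) (hX : MeasurableSet X) (ψ : L2R) :
    ‖chiMul X hX ψ‖ ^ 2 = ∫ x in X, ‖ψ x‖ ^ 2 := by
  have h : ((‖chiMul X hX ψ‖ ^ 2 : ℝ) : ℂ) = ((∫ x in X, ‖ψ x‖ ^ 2 : ℝ) : ℂ) := by
    have h1 := inner_chiMul_left X hX ψ (chiMul X hX ψ)
    rw [inner_self_eq_norm_sq_to_K] at h1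
    rw [← integral_complex_ofReal]
    push_cast
    rw [show (‖chiMul X hX ψ‖ : ℂ) ^ 2 = _ from h1, ← integral_indicator hX,
      ← integral_indicator hX]
    apply integral_congr_ae
    filter_upwards [coeFn_chiMul X hX ψ] with x hx
    by_cases h : x ∈ X
    · simp only [h, Set.indicator_of_mem, hx]
      rw [inner_self_eq_norm_sq_to_K]; simp
    · simp [h]
  exact_mod_cast h

lemma chiMul_union {X Y : Set ℝ} (hX : MeasurableSet X) (hY : MeasurableSet Y)
    (hd : Disjoint X Y) (ψ : L2R) :
    chiMul (X ∪ Y) (hX.union hY) ψ = chiMul X hX ψ + chiMul Y hY ψ := by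
  apply Lp.ext
  filter_upwards [coeFn_chiMul (X ∪ Y) (hX.union hY) ψ, coeFn_chiMul X hX ψ, coeFn_chiMul Y hY ψ,
    Lp.coeFn_add (chiMul X hX ψ) (chiMul Y hY ψ)] with x h1 h2 h3 h4
  rw [h1, h4, Pi.add_apply, h2, h3, Set.indicator_union_of_disjoint hd]

lemma chiMul_biUnion {X : ℕ → Set ℝ} (hX : ∀ i, MeasurableSet (X i))
    (hd : Pairwise (Function.onFun Disjoint X)) (ψ : L2R) (s : Finset ℕ) :
    ∑ i ∈ s, chiMul (X i) (hX i) ψ =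
      chiMul (⋃ i ∈ s, X i) (s.measurableSet_biUnion fun i _ => hX i) ψ := by
  induction s using Finset.induction_on with
  | empty =>
    rw [Finset.sum_empty]
    apply Lp.ext
    filter_upwards [coeFn_chiMul (⋃ i ∈ (∅ : Finset ℕ), X i)
      (Finset.measurableSet_biUnion _ fun i _ => hX i) ψ, Lp.coeFn_zero ℂ 2 volume] with x h1 h2
    rw [h1, h2]; simp
  | insert a s ha ih =>
    rw [Finset.sum_insert ha, ih, ← chiMul_union]
    · congr 2
      simp
    · exact Set.disjoint_iUnion₂_right.2 fun i hi => hd (fun h => ha (h ▸ hi))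

lemma hasSum_chiMul {X : ℕ → Set ℝ} (hX : ∀ i, MeasurableSet (X i))
    (hd : Pairwise (Function.onFun Disjoint X)) (ψ : L2R) :
    HasSum (fun i => chiMul (X i) (hX i) ψ) (chiMul (⋃ i, X i) (MeasurableSet.iUnion hX) ψ) := by
  have hint : Integrable (fun x => ‖ψ x‖ ^ 2) volume :=
    (memLp_two_iff_integrable_sq_norm (Lp.aestronglyMeasurable ψ)).1 (Lp.memLp ψ)
  have hs := hasSum_integral_iUnion (μ := volume) hX hd hint.integrableOn
  rw [HasSum, tendsto_iff_norm_sub_tendsto_zero]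
  have key : ∀ s : Finset ℕ,
      ‖∑ i ∈ s, chiMul (X i) (hX i) ψ - chiMul (⋃ i, X i) (MeasurableSet.iUnion hX) ψ‖ =
      Real.sqrt ((∫ x in ⋃ i, X i, ‖ψ x‖ ^ 2) - ∑ i ∈ s, ∫ x in X i, ‖ψ x‖ ^ 2) := by
    intro s
    set B : Set ℝ := ⋃ i ∈ s, X i with hB
    have hBm : MeasurableSet B := s.measurableSet_biUnion fun i _ => hX i
    have hBs : B ⊆ ⋃ i, X i := Set.iUnion₂_subset fun i _ => Set.subset_iUnion X i
    have hDm : MeasurableSet ((⋃ i, X i) \ B) := (MeasurableSet.iUnion hX).diff hBm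
    have h1 : chiMul (⋃ i, X i) (MeasurableSet.iUnion hX) ψ =
        chiMul B hBm ψ + chiMul ((⋃ i, X i) \ B) hDm ψ := by
      rw [← chiMul_union hBm hDm Set.disjoint_sdiff_right]
      congr 2
      exact (Set.union_sdiff_cancel hBs).symm
    rw [chiMul_biUnion hX hd, h1, sub_add_cancel_left, norm_neg, ← Real.sqrt_sq (norm_nonneg _),
      norm_chiMul_sq, setIntegral_sdiff hBm hint.integrableOn hBs,
      integral_biUnion_finset s (fun i _ => hX i) (fun i _ j _ hij => hd hij)
        (fun i _ => hint.integrableOn)]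
  simp_rw [key]
  have h2 := (tendsto_const_nhds (x := ∫ x in ⋃ i, X i, ‖ψ x‖ ^ 2)).sub hs
  rw [sub_self] at h2
  have h3 := (Real.continuous_sqrt.tendsto 0).comp h2
  rw [Real.sqrt_zero] at h3
  exact h3

open Classical in
/-- The sharp position observable on `L²(ℝ)`: `(Q_ℝ(X) ψ)(x) = χ_X(x) ψ(x)`. -/
def positionR : POVM ℝ L2R where
  op X := if hX : MeasurableSet X then chiMul X hX else 0
  isPositive X hX := by simpa [hX] using chiMul_isPositive X hX
  hasSum_iUnion X hX hd ψ := by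
    simpa [hX, MeasurableSet.iUnion hX] using hasSum_chiMul hX hd ψ

lemma map_dilation : Measure.map (fun x : ℝ => (2 * Real.pi)⁻¹ * x) volume =
    ENNReal.ofReal (2 * Real.pi) • (volume : Measure ℝ) := by
  have h : (2 * Real.pi)⁻¹ ≠ 0 := by positivity
  rw [Real.map_volume_mul_left h, inv_inv, abs_of_pos (by positivity)]

lemma quasiMeasurePreserving_dilation :
    Measure.QuasiMeasurePreserving (fun x : ℝ => (2 * Real.pi)⁻¹ * x) volume volume :=
  ⟨by fun_prop, by rw [map_dilation]; exact Measure.smul_absolutelyContinuous⟩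

lemma eLpNorm_dilation (g : L2R) :
    eLpNorm (fun x : ℝ => (Real.sqrt (2 * Real.pi) : ℂ)⁻¹ * g ((2 * Real.pi)⁻¹ * x)) 2 volume =
      eLpNorm g 2 volume := by
  have hpi : 0 < 2 * Real.pi := by positivity
  have h1 : eLpNorm (fun x : ℝ => g ((2 * Real.pi)⁻¹ * x)) 2 volume =
      ENNReal.ofReal (Real.sqrt (2 * Real.pi)) * eLpNorm g 2 volume := by
    have h2 := eLpNorm_map_measure (p := 2) (μ := volume) (g := g)
      (f := fun x : ℝ => (2 * Real.pi)⁻¹ * x)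
      (by rw [map_dilation]; exact (Lp.aestronglyMeasurable g).smul_measure _)
      (by fun_prop)
    rw [map_dilation, eLpNorm_smul_measure_of_ne_top (by simp)] at h2
    rw [show (fun x : ℝ => g ((2 * Real.pi)⁻¹ * x)) = g ∘ fun x : ℝ => (2 * Real.pi)⁻¹ * x from rfl,
      ← h2, smul_eq_mul, ENNReal.ofReal_rpow_of_pos hpi, Real.sqrt_eq_rpow]
    norm_num
  have h3 := eLpNorm_const_smul (p := 2) (μ := volume) ((Real.sqrt (2 * Real.pi) : ℂ)⁻¹)
    (fun x : ℝ => g ((2 * Real.pi)⁻¹ * x))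
  rw [show (fun x : ℝ => (Real.sqrt (2 * Real.pi) : ℂ)⁻¹ * g ((2 * Real.pi)⁻¹ * x)) =
    (Real.sqrt (2 * Real.pi) : ℂ)⁻¹ • (fun x : ℝ => g ((2 * Real.pi)⁻¹ * x)) from rfl, h3, h1,
    ← mul_assoc]
  have h4 : ‖((Real.sqrt (2 * Real.pi) : ℂ)⁻¹)‖ₑ = ENNReal.ofReal ((Real.sqrt (2 * Real.pi))⁻¹) := by
    rw [← ofReal_norm, norm_inv, Complex.norm_real, Real.norm_of_nonneg (by positivity)]
  rw [h4, ← ENNReal.ofReal_mul (by positivity), inv_mul_cancel₀ (by positivity)]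
  simp

lemma memLp_dilation (g : L2R) :
    MemLp (fun x : ℝ => (Real.sqrt (2 * Real.pi) : ℂ)⁻¹ * g ((2 * Real.pi)⁻¹ * x)) 2 volume :=
  ⟨((Lp.aestronglyMeasurable g).comp_quasiMeasurePreserving
    quasiMeasurePreserving_dilation).const_mul _, by
    rw [eLpNorm_dilation]; exact Lp.eLpNorm_lt_top g⟩

/-- The unitary dilation `(D g)(x) = (2π)^{-1/2} g(x / (2π))` of `L²(ℝ)`. -/
def dilation : L2R →ₗᵢ[ℂ] L2R where
  toFun g := (memLp_dilation g).toLp _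
  map_add' g h := by
    rw [← MemLp.toLp_add]
    apply MemLp.toLp_congr
    filter_upwards [quasiMeasurePreserving_dilation.ae (Lp.coeFn_add g h)] with x hx
    rw [Pi.add_apply, ← mul_add]
    exact congrArg _ hx
  map_smul' c g := by
    rw [RingHom.id_apply, ← MemLp.toLp_const_smul]
    apply MemLp.toLp_congr
    filter_upwards [quasiMeasurePreserving_dilation.ae (Lp.coeFn_smul c g)] with x hx
    rw [Pi.smul_apply, smul_eq_mul, mul_left_comm]
    exact congrArg _ hx
  norm_map' g := by
    simp only [LinearMap.coe_mk, AddHom.coe_mk, Lp.norm_toLp]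
    rw [eLpNorm_dilation, Lp.norm_def]

/-- The Fourier-Plancherel operator with the normalization
`(F ψ)(x) = (2π)^{-1/2} ∫ e^{-ixt} ψ(t) dt`; Mathlib's Fourier transform is
`(𝓕 ψ)(ξ) = ∫ e^{-2πiξt} ψ(t) dt`. -/
def fourierPlancherel : L2R →ₗᵢ[ℂ] L2R :=
  dilation.comp (Lp.fourierTransformₗᵢ ℝ ℂ).toLinearIsometry

/-- On Schwartz functions `fourierPlancherel` is the Fourier integral. -/
lemma fourierPlancherel_schwartz (ψ : SchwartzMap ℝ ℂ) :
    fourierPlancherel (ψ.toLp 2) =ᵐ[volume] fun x : ℝ =>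
      (Real.sqrt (2 * Real.pi) : ℂ)⁻¹ * ∫ t : ℝ, Complex.exp (-(Complex.I * x * t)) * ψ t := by
  have h1 : fourierPlancherel (ψ.toLp 2) = dilation ((𝓕 ψ).toLp 2) := by
    rw [← SchwartzMap.toLp_fourier_eq]; rfl
  rw [h1]
  filter_upwards [MemLp.coeFn_toLp (memLp_dilation ((𝓕 ψ).toLp 2)),
    quasiMeasurePreserving_dilation.ae ((𝓕 ψ).coeFn_toLp 2 volume)] with x hx hx2
  refine hx.trans ?_
  rw [hx2, SchwartzMap.fourier_coe, Real.fourier_eq']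
  congr 1
  apply integral_congr_ae
  filter_upwards with t
  rw [smul_eq_mul]
  congr 2
  simp only [RCLike.inner_apply, conj_trivial]
  push_cast
  field_simp

/-- The sharp momentum observable on `L²(ℝ)`: `P_ℝ(Y) = F* Q_ℝ(Y) F`. -/
def momentumR : POVM ℝ L2R := positionR.compress fourierPlancherel.toContinuousLinearMap

/-! ### The bounded interval -/

/-- The isometry `U : L²([0, ℓ]) → L²(ℝ)` extending functions by zero. -/
def extendZero (ℓ : ℝ) : L2I ℓ →ₗᵢ[ℂ] L2R where
  toFun φ := ((memLp_indicator_iff_restrict measurableSet_Icc).2 (Lp.memLp φ)).toLp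
    ((Set.Icc 0 ℓ).indicator φ)
  map_add' φ χ := by
    rw [← MemLp.toLp_add]
    apply MemLp.toLp_congr
    filter_upwards [(ae_restrict_iff' measurableSet_Icc).1 (Lp.coeFn_add φ χ)] with x hx
    by_cases h : x ∈ Set.Icc 0 ℓ
    · simp only [h, Set.indicator_of_mem, Pi.add_apply]
      exact hx h
    · simp [h]
  map_smul' c φ := by
    rw [RingHom.id_apply, ← MemLp.toLp_const_smul]
    apply MemLp.toLp_congr
    filter_upwards [(ae_restrict_iff' measurableSet_Icc).1 (Lp.coeFn_smul c φ)] with x hx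
    by_cases h : x ∈ Set.Icc 0 ℓ
    · simp only [h, Set.indicator_of_mem, Pi.smul_apply]
      exact hx h
    · simp [h]
  norm_map' φ := by
    simp only [LinearMap.coe_mk, AddHom.coe_mk, Lp.norm_toLp]
    rw [eLpNorm_indicator_eq_eLpNorm_restrict measurableSet_Icc, Lp.norm_def]

/-- The momentum POVM of a particle confined to `[0, ℓ]`: `P(Y) = U* P_ℝ(Y) U`. -/
def momentum (ℓ : ℝ) : POVM ℝ (L2I ℓ) := momentumR.compress (extendZero ℓ).toContinuousLinearMap

/-- `g` is an absolutely continuous representative of `φ` on `[0, ℓ]` with derivative in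
`L²([0, ℓ])`, and it vanishes at both endpoints. -/
structure IsDirichletRep (ℓ : ℝ) (φ : L2I ℓ) (g : ℝ → ℂ) : Prop where
  ac : AbsolutelyContinuousOnInterval g 0 ℓ
  memLp_deriv : MemLp (deriv g) 2 (volume.restrict (Set.Icc 0 ℓ))
  ae_eq : φ =ᵐ[volume.restrict (Set.Icc 0 ℓ)] g
  zero_left : g 0 = 0
  zero_right : g ℓ = 0

lemma ae_differentiableAt_of_ac {ℓ : ℝ} {g : ℝ → ℂ} (hg : AbsolutelyContinuousOnInterval g 0 ℓ) :
    ∀ᵐ x ∂(volume.restrict (Set.Icc 0 ℓ)), DifferentiableAt ℝ g x := by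
  rw [ae_restrict_iff' measurableSet_Icc]
  filter_upwards [hg.boundedVariationOn.ae_differentiableAt_of_mem_uIcc] with x hx hm
  exact hx (Set.Icc_subset_uIcc hm)

lemma deriv_add_ae {ℓ : ℝ} {g h : ℝ → ℂ} (hg : AbsolutelyContinuousOnInterval g 0 ℓ)
    (hh : AbsolutelyContinuousOnInterval h 0 ℓ) :
    deriv (g + h) =ᵐ[volume.restrict (Set.Icc 0 ℓ)] deriv g + deriv h := by
  filter_upwards [ae_differentiableAt_of_ac hg, ae_differentiableAt_of_ac hh] with x h1 h2
  exact deriv_add h1 h2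

lemma deriv_smul_ae {ℓ : ℝ} {g : ℝ → ℂ} (c : ℂ) (hg : AbsolutelyContinuousOnInterval g 0 ℓ) :
    deriv (c • g) =ᵐ[volume.restrict (Set.Icc 0 ℓ)] c • deriv g := by
  filter_upwards [ae_differentiableAt_of_ac hg] with x h1
  exact deriv_const_smul c h1

lemma IsDirichletRep.add {ℓ : ℝ} {φ χ : L2I ℓ} {g h : ℝ → ℂ} (hg : IsDirichletRep ℓ φ g)
    (hh : IsDirichletRep ℓ χ h) : IsDirichletRep ℓ (φ + χ) (g + h) where
  ac := hg.ac.add hh.ac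
  memLp_deriv := (memLp_congr_ae (deriv_add_ae hg.ac hh.ac)).2 (hg.memLp_deriv.add hh.memLp_deriv)
  ae_eq := by
    filter_upwards [Lp.coeFn_add φ χ, hg.ae_eq, hh.ae_eq] with x h1 h2 h3
    rw [h1, Pi.add_apply, h2, h3, Pi.add_apply]
  zero_left := by simp [hg.zero_left, hh.zero_left]
  zero_right := by simp [hg.zero_right, hh.zero_right]

lemma IsDirichletRep.smul {ℓ : ℝ} {φ : L2I ℓ} {g : ℝ → ℂ} (c : ℂ) (hg : IsDirichletRep ℓ φ g) :
    IsDirichletRep ℓ (c • φ) (c • g) where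
  ac := hg.ac.const_smul c
  memLp_deriv := (memLp_congr_ae (deriv_smul_ae c hg.ac)).2 (hg.memLp_deriv.const_smul c)
  ae_eq := by
    filter_upwards [Lp.coeFn_smul c φ, hg.ae_eq] with x h1 h2
    rw [h1, Pi.smul_apply, h2, Pi.smul_apply]
  zero_left := by simp [hg.zero_left]
  zero_right := by simp [hg.zero_right]

lemma IsDirichletRep.zero (ℓ : ℝ) : IsDirichletRep ℓ 0 0 where
  ac := by
    have h : LipschitzOnWith 0 (0 : ℝ → ℂ) (Set.uIcc 0 ℓ) := (LipschitzWith.const 0).lipschitzOnWith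
    exact h.absolutelyContinuousOnInterval
  memLp_deriv := by
    have h : deriv (0 : ℝ → ℂ) = 0 := by ext x; simp
    rw [h]; exact MemLp.zero
  ae_eq := Lp.coeFn_zero ℂ 2 _
  zero_left := rfl
  zero_right := rfl

/-- The derivative does not depend on the choice of the representative. -/
lemma IsDirichletRep.deriv_ae_eq {ℓ : ℝ} {φ : L2I ℓ} {g h : ℝ → ℂ} (hg : IsDirichletRep ℓ φ g)
    (hh : IsDirichletRep ℓ φ h) : deriv g =ᵐ[volume.restrict (Set.Icc 0 ℓ)] deriv h := by
  have hae : g =ᵐ[volume.restrict (Set.Ioo 0 ℓ)] h :=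
    ae_restrict_of_ae_restrict_of_subset Set.Ioo_subset_Icc_self (hg.ae_eq.symm.trans hh.ae_eq)
  have hsub : Set.Ioo 0 ℓ ⊆ Set.uIcc 0 ℓ := Set.Ioo_subset_Icc_self.trans Set.Icc_subset_uIcc
  have heq : Set.EqOn g h (Set.Ioo 0 ℓ) :=
    Measure.eqOn_open_of_ae_eq hae isOpen_Ioo (hg.ac.continuousOn.mono hsub)
      (hh.ac.continuousOn.mono hsub)
  rw [← restrict_Ioo_eq_restrict_Icc]
  filter_upwards [ae_restrict_mem measurableSet_Ioo] with x hx
  exact Filter.EventuallyEq.deriv_eq (heq.eventuallyEq_of_mem (isOpen_Ioo.mem_nhds hx))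

/-- The operator `P₀ = -i d/dx` on `L²([0, ℓ])` with Dirichlet boundary conditions: its domain
consists of the absolutely continuous `φ` with `φ' ∈ L²([0, ℓ])` and `φ(0) = φ(ℓ) = 0`. -/
def dirichletMomentum (ℓ : ℝ) : L2I ℓ →ₗ.[ℂ] L2I ℓ where
  domain :=
    { carrier := {φ | ∃ g, IsDirichletRep ℓ φ g}
      add_mem' := fun ⟨_, hg⟩ ⟨_, hh⟩ => ⟨_, hg.add hh⟩
      zero_mem' := ⟨_, IsDirichletRep.zero ℓ⟩
      smul_mem' := fun c _ ⟨_, hg⟩ => ⟨_, hg.smul c⟩ }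
  toFun :=
    { toFun := fun φ => (-Complex.I) • (φ.2.choose_spec.memLp_deriv).toLp (deriv φ.2.choose)
      map_add' := fun φ χ => by
        rw [← smul_add, ← MemLp.toLp_add]
        congr 1
        apply MemLp.toLp_congr
        exact ((φ + χ).2.choose_spec.deriv_ae_eq
          (φ.2.choose_spec.add χ.2.choose_spec)).trans
            (deriv_add_ae φ.2.choose_spec.ac χ.2.choose_spec.ac)
      map_smul' := fun c φ => by
        rw [RingHom.id_apply, smul_comm c,
          ← MemLp.toLp_const_smul c φ.2.choose_spec.memLp_deriv]
        refine congrArg (fun u : L2I ℓ => (-Complex.I) • u) ?_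
        apply MemLp.toLp_congr
        exact ((c • φ).2.choose_spec.deriv_ae_eq (φ.2.choose_spec.smul c)).trans
            (deriv_smul_ae c φ.2.choose_spec.ac) }

end MomentumMoments
end

/-! Write ψ = F U φ. The complex measure ⟪χ, P(·)φ⟫ has density conj(F U χ)·ψ, so every statement
about P(·)φ becomes one about ψ. The theorem follows from a cycle of inclusions of graphs: P₀ⁿ ⊆
P̃[n] ⊆ P[n] ⊆ P₀ⁿ.

If φ ∈ dom P₀ⁿ, integration by parts without boundary terms gives F U P₀ⁿφ = xⁿψ. Hence xⁿψ is
square integrable, which is the square integrability condition, and dominated convergence in L²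
produces the vector integral P₀ⁿφ (`fourierPlancherel_opPow`, `hasVectorIntegral_of_memLp`).

The last inclusion carries the weight. By a Vitali–Hahn–Saks argument a vector integral is also a
weak integral (`inner_eq_integral_of_hasVectorIntegral`): xⁿψ·conj(F U χ) is integrable for every χ.
For n = 1 this forces φ ∈ dom P₀ (`WeaklyIntegrable.mem_domain`). Translating a function only
multiplies its transform by a phase, so integrability persists for test functions supported in any
interval of length ℓ, hence for those supported in [-ℓ, 2ℓ]. Banach–Steinhaus and Riesz then give
the zero extension of φ a square integrable weak derivative on this neighbourhood of [0, ℓ]. So the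
extension has an absolutely continuous representative there; as it vanishes outside [0, ℓ],
continuity gives both boundary conditions. Higher n follow by induction, since the transform of P₀ⁿφ
is xⁿψ. -/

namespace MomentumMoments

/-! ### Convergence of integrals over all measurable sets (Vitali–Hahn–Saks) -/

section VitaliHahnSaks

variable {α : Type*} [MeasurableSpace α] {μ : Measure α}

open scoped symmDiff

/-- Completeness of the space of measurable sets under the distance μ(s ∆ t) is what the Baire
category argument below requires. -/
instance completeSpace_measuredSets : CompleteSpace (MeasuredSets μ) := by
  refine EMetric.complete_of_convergent_controlled_sequences (fun n => (2⁻¹ : ℝ≥0∞) ^ n)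
    (fun n => ENNReal.pow_pos (by simp) n) fun u hu => ?_
  -- The limit is the limsup of the sets. A point that lies in no difference of consecutive sets
  -- from index k on has constant membership from there on, so u k ∆ S is covered by those
  -- differences, whose measures are summed geometrically.
  let S : Set α := ⋂ k, ⋃ j, (u (k + j) : Set α)
  have hS : MeasurableSet S := MeasurableSet.iInter fun k => MeasurableSet.iUnion fun j =>
    (u (k + j)).2
  let T : MeasuredSets μ := ⟨S, hS⟩
  refine ⟨T, ?_⟩
  have hbound : ∀ k, edist (u k) T ≤ 2 * (2⁻¹ : ℝ≥0∞) ^ k := by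
    intro k
    have hsub : ((u k : Set α) ∆ S) ⊆ ⋃ j, ((u (k + j) : Set α) ∆ (u (k + j + 1))) := by
      intro x hx
      by_contra hne
      simp only [Set.mem_iUnion, not_exists, Set.mem_symmDiff, not_or, not_and, not_not] at hne
      have hconst : ∀ j, x ∈ (u (k + j) : Set α) ↔ x ∈ (u k : Set α) := by
        intro j
        induction j with
        | zero => rfl
        | succ j ih => exact ⟨fun h => ih.1 ((hne j).2 h), fun h => (hne j).1 (ih.2 h)⟩
      have hxS : x ∈ S ↔ x ∈ (u k : Set α) := by
        constructor
        · intro h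
          obtain ⟨j, hj⟩ := Set.mem_iUnion.1 (Set.mem_iInter.1 h k)
          exact (hconst j).1 hj
        · intro h
          refine Set.mem_iInter.2 fun i => Set.mem_iUnion.2 ⟨k, ?_⟩
          rw [add_comm]
          exact (hconst i).2 h
      rcases hx with ⟨h1, h2⟩ | ⟨h1, h2⟩
      · exact h2 (hxS.2 h1)
      · exact h2 (hxS.1 h1)
    calc edist (u k) T ≤ μ (⋃ j, ((u (k + j) : Set α) ∆ (u (k + j + 1)))) := measure_mono hsub
      _ ≤ ∑' j, μ ((u (k + j) : Set α) ∆ (u (k + j + 1))) := measure_iUnion_le _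
      _ ≤ ∑' j, (2⁻¹ : ℝ≥0∞) ^ (k + j) := ENNReal.tsum_le_tsum fun j =>
          (hu (k + j) (k + j) (k + j + 1) le_rfl (Nat.le_succ _)).le
      _ = 2 * (2⁻¹ : ℝ≥0∞) ^ k := by
          simp_rw [pow_add]
          rw [ENNReal.tsum_mul_left, ENNReal.tsum_geometric, mul_comm, ENNReal.one_sub_inv_two,
            inv_inv]
  rw [EMetric.tendsto_atTop]
  intro ε hε
  have ht : Tendsto (fun k => 2 * (2⁻¹ : ℝ≥0∞) ^ k) atTop (𝓝 0) := by
    have := ENNReal.Tendsto.const_mul (a := 2)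
      (ENNReal.tendsto_pow_atTop_nhds_zero_of_lt_one (r := 2⁻¹) (by simp)) (Or.inr (by simp))
    simpa using this
  obtain ⟨N, hN⟩ := eventually_atTop.1 ((tendsto_order.1 ht).2 ε hε)
  exact ⟨N, fun k hk => (hbound k).trans_lt (hN k hk)⟩

lemma norm_setIntegral_sub_le {E : Type*} [NormedAddCommGroup E] [NormedSpace ℝ E]
    {f : α → E} (hf : Integrable f μ)
    {s t : Set α} (hs : MeasurableSet s) (ht : MeasurableSet t) :
    ‖∫ x in s, f x ∂μ - ∫ x in t, f x ∂μ‖ ≤ ∫ x in s ∆ t, ‖f x‖ ∂μ := by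
  rw [← integral_indicator hs, ← integral_indicator ht,
    ← integral_sub (hf.indicator hs) (hf.indicator ht), ← integral_indicator (hs.symmDiff ht)]
  refine norm_integral_le_of_norm_le (hf.norm.indicator (hs.symmDiff ht)) (ae_of_all _ fun x => ?_)
  by_cases h1 : x ∈ s <;> by_cases h2 : x ∈ t <;> simp [h1, h2, Set.mem_symmDiff]

/-- This is absolute continuity of the integral; it makes the sets in the Baire argument closed. -/
lemma continuous_setIntegral {E : Type*} [NormedAddCommGroup E] [NormedSpace ℝ E]
    {f : α → E} (hf : Integrable f μ) :
    Continuous fun s : MeasuredSets μ => ∫ x in (s : Set α), f x ∂μ := by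
  rw [continuous_iff_continuousAt]
  intro s
  have h0 : Tendsto (fun t : MeasuredSets μ => μ ((t : Set α) ∆ s)) (𝓝 s) (𝓝 0) :=
    tendsto_iff_edist_tendsto_0.1 (tendsto_id (x := 𝓝 s))
  have h1 := hf.norm.tendsto_setIntegral_nhds_zero h0
  rw [ContinuousAt, tendsto_iff_norm_sub_tendsto_zero]
  exact squeeze_zero (fun _ => norm_nonneg _) (fun t => norm_setIntegral_sub_le hf t.2 s.2) h1

/-- The bound c is applied to the parts of B where f ≥ 0 and where f ≤ 0. The complex version does
this for real and imaginary parts, whence its factor 4. -/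
lemma setIntegral_abs_le_of_forall_subset {f : α → ℝ} (hf : Integrable f μ)
    (hm : StronglyMeasurable f) {B : Set α} (hB : MeasurableSet B) {c : ℝ}
    (h : ∀ A, MeasurableSet A → A ⊆ B → |∫ x in A, f x ∂μ| ≤ c) :
    ∫ x in B, |f x| ∂μ ≤ 2 * c := by
  have h1 := integral_norm_eq_pos_sub_neg (hf.restrict (s := B))
  have m1 : MeasurableSet {x | 0 ≤ f x} := measurableSet_le measurable_const hm.measurable
  have m2 : MeasurableSet {x | f x ≤ 0} := measurableSet_le hm.measurable measurable_const
  rw [Measure.restrict_restrict m1, Measure.restrict_restrict m2] at h1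
  simp only [Real.norm_eq_abs] at h1
  rw [h1]
  have a1 := abs_le.1 (h _ (m1.inter hB) Set.inter_subset_right)
  have a2 := abs_le.1 (h _ (m2.inter hB) Set.inter_subset_right)
  linarith [a1.2, a2.1]

lemma setIntegral_norm_le_of_forall_subset {f : α → ℂ} (hf : Integrable f μ)
    (hm : StronglyMeasurable f) {B : Set α} (hB : MeasurableSet B) {c : ℝ}
    (h : ∀ A, MeasurableSet A → A ⊆ B → ‖∫ x in A, f x ∂μ‖ ≤ c) :
    ∫ x in B, ‖f x‖ ∂μ ≤ 4 * c := by
  have h1 : ∫ x in B, |(f x).re| ∂μ ≤ 2 * c :=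
    setIntegral_abs_le_of_forall_subset hf.re (Complex.continuous_re.comp_stronglyMeasurable hm) hB
      fun A hA hAB => by
        have h2 := integral_re (hf.restrict (s := A))
        simp only [RCLike.re_to_complex] at h2
        exact (congrArg abs h2).le.trans ((Complex.abs_re_le_norm _).trans (h A hA hAB))
  have h2 : ∫ x in B, |(f x).im| ∂μ ≤ 2 * c :=
    setIntegral_abs_le_of_forall_subset hf.im (Complex.continuous_im.comp_stronglyMeasurable hm) hB
      fun A hA hAB => by
        have h2 := integral_im (hf.restrict (s := A))
        simp only [RCLike.im_to_complex] at h2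
        exact (congrArg abs h2).le.trans ((Complex.abs_im_le_norm _).trans (h A hA hAB))
  have i1 : Integrable (fun x => |(f x).re|) (μ.restrict B) := hf.re.abs.restrict
  have i2 : Integrable (fun x => |(f x).im|) (μ.restrict B) := hf.im.abs.restrict
  calc ∫ x in B, ‖f x‖ ∂μ ≤ ∫ x in B, (|(f x).re| + |(f x).im|) ∂μ :=
        integral_mono hf.norm.restrict (i1.add i2) fun x => Complex.norm_le_abs_re_add_abs_im _
    _ ≤ 4 * c := by rw [integral_add i1 i2]; linarith

/-- If the integrals of `h k` over every measurable set converge, then the `h k` are uniformly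
Cauchy on sets of small measure. -/
lemma exists_forall_setIntegral_norm_sub_le [IsFiniteMeasure μ] {h : ℕ → α → ℂ}
    (hint : ∀ k, Integrable (h k) μ) (hm : ∀ k, StronglyMeasurable (h k))
    (hconv : ∀ A, MeasurableSet A → ∃ w, Tendsto (fun k => ∫ x in A, h k x ∂μ) atTop (𝓝 w))
    {ε : ℝ} (hε : 0 < ε) :
    ∃ N : ℕ, ∃ δ : ℝ≥0∞, 0 < δ ∧ ∀ B, MeasurableSet B → μ B < δ → ∀ k ≥ N, ∀ j ≥ N,
      ∫ x in B, ‖h k x - h j x‖ ∂μ ≤ ε := by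
  -- Baire category: these closed sets exhaust a complete space, so one of them contains a ball.
  let C : ℕ → Set (MeasuredSets μ) := fun N =>
    {s | ∀ k ≥ N, ∀ j ≥ N, ‖∫ x in (s : Set α), h k x ∂μ - ∫ x in (s : Set α), h j x ∂μ‖ ≤ ε / 8}
  have hC : ∀ N, IsClosed (C N) := fun N => by
    simp only [C, Set.ofPred_forall]
    exact isClosed_iInter fun k => isClosed_iInter fun _ => isClosed_iInter fun j =>
      isClosed_iInter fun _ => isClosed_le
        ((continuous_setIntegral (hint k)).sub (continuous_setIntegral (hint j))).norm
        continuous_const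
  have hU : ⋃ N, C N = Set.univ := by
    refine Set.eq_univ_of_forall fun s => ?_
    obtain ⟨w, hw⟩ := hconv s s.2
    obtain ⟨N, hN⟩ := Metric.cauchySeq_iff.1 hw.cauchySeq (ε / 8) (by positivity)
    exact Set.mem_iUnion.2 ⟨N, fun k hk j hj => by
      rw [← dist_eq_norm]; exact (hN k hk j hj).le⟩
  have : Nonempty (MeasuredSets μ) := ⟨⟨∅, MeasurableSet.empty⟩⟩
  obtain ⟨N, A, hA⟩ := nonempty_interior_of_iUnion_of_closed hC hU
  obtain ⟨δ, hδ, hball⟩ := EMetric.mem_nhds_iff.1 (mem_interior_iff_mem_nhds.1 hA)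
  have key : ∀ B, MeasurableSet B → μ B < δ → ∀ k ≥ N, ∀ j ≥ N,
      ‖∫ x in B, (h k x - h j x) ∂μ‖ ≤ ε / 4 := by
    intro B hB hBδ k hk j hj
    -- For small B both A ∪ B and A \ B lie in the ball around A, and the integral over B is the
    -- difference of the integrals over these two sets.
    let A₁ : MeasuredSets μ := ⟨A ∪ B, A.2.union hB⟩
    let A₂ : MeasuredSets μ := ⟨A \ B, A.2.diff hB⟩
    have e1 : edist A₁ A < δ := by
      refine lt_of_le_of_lt (measure_mono ?_) hBδ
      rintro x (⟨h1 | h1, h2⟩ | ⟨h1, h2⟩)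
      · exact absurd h1 h2
      · exact h1
      · exact absurd (Or.inl h1) h2
    have e2 : edist A₂ A < δ := by
      refine lt_of_le_of_lt (measure_mono ?_) hBδ
      rintro x (⟨h1, h2⟩ | ⟨h1, h2⟩)
      · exact absurd h1.1 h2
      · by_contra h3
        exact h2 ⟨h1, h3⟩
    have b1 := hball e1 k hk j hj
    have b2 := hball e2 k hk j hj
    have hint' : Integrable (fun x => h k x - h j x) μ := (hint k).sub (hint j)
    rw [← integral_sub (hint k).restrict (hint j).restrict] at b1 b2
    replace b1 : ‖∫ x in (A : Set α) ∪ B, (h k x - h j x) ∂μ‖ ≤ ε / 8 := b1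
    replace b2 : ‖∫ x in (A : Set α) \ B, (h k x - h j x) ∂μ‖ ≤ ε / 8 := b2
    have hsplit : ∫ x in B, (h k x - h j x) ∂μ = ∫ x in (A : Set α) ∪ B, (h k x - h j x) ∂μ -
        ∫ x in (A : Set α) \ B, (h k x - h j x) ∂μ := by
      rw [← Set.sdiff_union_self, setIntegral_union Set.disjoint_sdiff_left hB hint'.integrableOn
        hint'.integrableOn, add_sub_cancel_left]
    rw [hsplit]
    exact (norm_sub_le _ _).trans (by linarith)
  refine ⟨N, δ, hδ, fun B hB hBδ k hk j hj => ?_⟩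
  have := setIntegral_norm_le_of_forall_subset ((hint k).sub (hint j)) ((hm k).sub (hm j)) hB
    (c := ε / 4) fun A hA hAB => key A hA ((measure_mono hAB).trans_lt hBδ) k hk j hj
  simpa using this.trans_eq (by ring)

/-- No dominating function is available. Egorov's theorem gives uniform convergence off a small set,
and the Baire estimate controls the small set, so the sequence is Cauchy in L¹; Fatou then
identifies its limit with f. -/
theorem integrable_and_tendsto_integral_of_setIntegral_tendsto [IsFiniteMeasure μ]
    {h : ℕ → α → ℂ} {f : α → ℂ}
    (hint : ∀ k, Integrable (h k) μ) (hm : ∀ k, StronglyMeasurable (h k))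
    (hlim : ∀ x, Tendsto (fun k => h k x) atTop (𝓝 (f x)))
    (hconv : ∀ A, MeasurableSet A → ∃ w, Tendsto (fun k => ∫ x in A, h k x ∂μ) atTop (𝓝 w)) :
    Integrable f μ ∧ Tendsto (fun k => ∫ x, h k x ∂μ) atTop (𝓝 (∫ x, f x ∂μ)) := by
  have hfm : StronglyMeasurable f := stronglyMeasurable_of_tendsto atTop hm (tendsto_pi_nhds.2 hlim)
  have hcauchy : ∀ ε : ℝ, 0 < ε → ∃ N, ∀ k ≥ N, ∀ j ≥ N, ∫ x, ‖h k x - h j x‖ ∂μ ≤ ε := by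
    intro ε hε
    obtain ⟨N, δ, hδ, hN⟩ := exists_forall_setIntegral_norm_sub_le hint hm hconv (half_pos hε)
    obtain ⟨δ', hδ', hδδ⟩ : ∃ δ' : ℝ, 0 < δ' ∧ ENNReal.ofReal δ' < δ := by
      obtain ⟨r, hr0, hr⟩ := ENNReal.lt_iff_exists_nnreal_btwn.1 hδ
      exact ⟨r, by exact_mod_cast hr0, by simpa using hr⟩
    obtain ⟨B, hB, hBδ, hunif⟩ := tendstoUniformlyOn_of_ae_tendsto' (μ := μ) hm hfm
      (ae_of_all _ hlim) hδ'
    set M := μ.real Set.univ with hM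
    have hM0 : 0 ≤ M := measureReal_nonneg
    obtain ⟨N', hN'⟩ := eventually_atTop.1
      -- Twice this constant, times the total mass M, is at most ε / 2; adding 1 avoids dividing by
      -- zero when M = 0.
      (Metric.tendstoUniformlyOn_iff.1 hunif (ε / (4 * (M + 1))) (by positivity))
    refine ⟨max N N', fun k hk j hj => ?_⟩
    have hI : Integrable (fun x => ‖h k x - h j x‖) μ := ((hint k).sub (hint j)).norm
    have h1 := hN B hB (hBδ.trans_lt hδδ) k (le_of_max_le_left hk) j (le_of_max_le_left hj)
    have h2 : ∫ x in Bᶜ, ‖h k x - h j x‖ ∂μ ≤ ε / 2 := by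
      have hb : ∀ x ∈ Bᶜ, ‖(‖h k x - h j x‖)‖ ≤ ε / (2 * (M + 1)) := by
        intro x hx
        rw [norm_norm, ← dist_eq_norm]
        have a1 := hN' k (le_of_max_le_right hk) x hx
        have a2 := hN' j (le_of_max_le_right hj) x hx
        have a3 := dist_triangle_left (h k x) (h j x) (f x)
        have a4 : ε / (2 * (M + 1)) = ε / (4 * (M + 1)) + ε / (4 * (M + 1)) := by
          field_simp; ring
        linarith
      have h3 := norm_setIntegral_le_of_norm_le_const (measure_lt_top μ Bᶜ) hb
      have h4 : μ.real Bᶜ ≤ M := measureReal_mono (Set.subset_univ _)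
      calc ∫ x in Bᶜ, ‖h k x - h j x‖ ∂μ ≤ ε / (2 * (M + 1)) * μ.real Bᶜ :=
            (Real.le_norm_self _).trans h3
        _ ≤ ε / (2 * (M + 1)) * (M + 1) := by gcongr; linarith
        _ = ε / 2 := by field_simp
    rw [← integral_add_compl hB hI]
    linarith
  have hlim1 : ∀ ε : ℝ, 0 < ε → ∃ N, ∀ k ≥ N, eLpNorm (h k - f) 1 μ ≤ ENNReal.ofReal ε := by
    intro ε hε
    obtain ⟨N, hN⟩ := hcauchy ε hε
    refine ⟨N, fun k hk => ?_⟩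
    have hF := Lp.eLpNorm_lim_le_liminf_eLpNorm (p := 1) (μ := μ) (f := fun j => h k - h j)
      (fun j => ((hm k).sub (hm j)).aestronglyMeasurable) (h k - f)
      (ae_of_all _ fun x => tendsto_const_nhds.sub (hlim x))
    refine hF.trans (liminf_le_of_le (by isBoundedDefault) fun b hb => ?_)
    obtain ⟨j, hj1, hj2⟩ := (hb.and (eventually_ge_atTop N)).exists
    refine hj1.trans ?_
    rw [eLpNorm_one_eq_lintegral_enorm, ← ofReal_integral_norm_eq_lintegral_enorm
      ((hint k).sub (hint j))]
    exact ENNReal.ofReal_le_ofReal (hN k hk j hj2)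
  have hfint : Integrable f μ := by
    obtain ⟨N, hN⟩ := hlim1 1 one_pos
    have h1 : MemLp (h N - f) 1 μ :=
      ⟨((hm N).sub hfm).aestronglyMeasurable, (hN N le_rfl).trans_lt ENNReal.ofReal_lt_top⟩
    have h2 := (memLp_one_iff_integrable.2 (hint N)).sub h1
    rw [sub_sub_cancel] at h2
    exact memLp_one_iff_integrable.1 h2
  refine ⟨hfint, tendsto_integral_of_L1' f hfm.aestronglyMeasurable (Eventually.of_forall hint) ?_⟩
  rw [ENNReal.tendsto_atTop_zero]
  intro ε hε
  obtain ⟨r, hr0, hr⟩ := ENNReal.lt_iff_exists_nnreal_btwn.1 hε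
  obtain ⟨N, hN⟩ := hlim1 r (by exact_mod_cast hr0)
  exact ⟨N, fun k hk => (hN k hk).trans (by simpa using hr.le)⟩

end VitaliHahnSaks

/-! ### The Plancherel transform of integrable functions as an integral -/

section Fourier

open scoped ContDiff

/-- Both sides are tested against smooth compactly supported g. For the L² transform the Fourier
operator moves onto g by the definition on tempered distributions, for the integral by Fubini; the
results agree. -/
lemma fourier_Lp_ae_eq (h : L2R) (hi : Integrable h) : (𝓕 h : L2R) =ᵐ[volume] 𝓕 (h : ℝ → ℂ) := by
  have hcont : Continuous (𝓕 (h : ℝ → ℂ)) :=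
    VectorFourier.fourierIntegral_continuous Real.continuous_fourierChar continuous_inner hi
  have hloc : LocallyIntegrable ((𝓕 h : L2R) : ℝ → ℂ) :=
    (Lp.memLp (𝓕 h : L2R)).locallyIntegrable one_le_two
  rw [← sub_ae_eq_zero]
  refine ae_eq_zero_of_integral_contDiff_smul_eq_zero (hloc.sub hcont.locallyIntegrable)
    fun g g_smooth g_cpt => ?_
  have hg₁ : HasCompactSupport (Complex.ofRealCLM ∘ g) := g_cpt.comp_left rfl
  have hg₂ : ContDiff ℝ ∞ (Complex.ofRealCLM ∘ g) := by fun_prop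
  let G : SchwartzMap ℝ ℂ := hg₁.toSchwartzMap hg₂
  have h1 : ∫ x, g x • (𝓕 h : L2R) x = ∫ x, (𝓕 G) x • h x := by
    have h2 := congrArg (fun T => T G) (Lp.fourier_toTemperedDistribution_eq h)
    rw [TemperedDistribution.fourier_apply, Lp.toTemperedDistribution_apply,
      Lp.toTemperedDistribution_apply] at h2
    rw [h2]
    exact integral_congr_ae (ae_of_all _ fun x => by simp [G])
  have h3 : ∫ x, (𝓕 G) x • h x = ∫ x, g x • 𝓕 (h : ℝ → ℂ) x := by
    have h4 := VectorFourier.integral_fourierIntegral_smul_eq_flip (L := innerₗ ℝ)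
      Real.continuous_fourierChar continuous_inner (G.integrable (μ := volume)) hi
    simp only [flip_innerₗ] at h4
    rw [SchwartzMap.fourier_coe]
    refine Eq.trans h4 (integral_congr_ae (ae_of_all _ fun x => ?_))
    rfl
  have i1 : Integrable fun x => g x • (𝓕 h : L2R) x :=
    hloc.integrable_smul_left_of_hasCompactSupport g_smooth.continuous g_cpt
  have i2 : Integrable fun x => g x • 𝓕 (h : ℝ → ℂ) x :=
    hcont.locallyIntegrable.integrable_smul_left_of_hasCompactSupport g_smooth.continuous g_cpt
  simp only [Pi.sub_apply, smul_sub]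
  rw [integral_sub i1 i2, h1, h3, sub_self]

/-- On integrable functions `fourierPlancherel` is the Fourier integral. -/
lemma fourierPlancherel_ae_eq (h : L2R) (hi : Integrable h) :
    fourierPlancherel h =ᵐ[volume] fun x : ℝ =>
      (Real.sqrt (2 * Real.pi) : ℂ)⁻¹ * ∫ t : ℝ, Complex.exp (-(Complex.I * x * t)) * h t := by
  have h1 : fourierPlancherel h = dilation (𝓕 h) := rfl
  rw [h1]
  filter_upwards [MemLp.coeFn_toLp (memLp_dilation (𝓕 h)),
    quasiMeasurePreserving_dilation.ae (fourier_Lp_ae_eq h hi)] with x hx hx2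
  refine hx.trans ?_
  rw [hx2, Real.fourier_eq']
  congr 1
  apply integral_congr_ae
  filter_upwards with t
  rw [smul_eq_mul]
  congr 2
  simp only [RCLike.inner_apply, conj_trivial]
  push_cast
  field_simp

/-- Functions in `L²(ℝ)` vanishing outside a bounded set are integrable. -/
lemma integrable_of_ae_eq_zero (h : L2R) {a b : ℝ} (h0 : ∀ᵐ t, t ∉ Set.Icc a b → h t = 0) :
    Integrable h := by
  have h1 : IntegrableOn h (Set.Icc a b) :=
    ((Lp.memLp h).restrict (Set.Icc a b)).integrable one_le_two
  exact h1.integrable_of_ae_notMem_eq_zero h0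

end Fourier

/-! ### Calculus of absolutely continuous complex functions -/

section AbsolutelyContinuous

open ComplexConjugate

lemma absolutelyContinuousOnInterval_congr {f g : ℝ → ℂ} {a b : ℝ}
    (hfg : Set.EqOn f g (Set.uIcc a b)) (hg : AbsolutelyContinuousOnInterval g a b) :
    AbsolutelyContinuousOnInterval f a b := by
  rw [absolutelyContinuousOnInterval_iff] at hg ⊢
  intro ε hε
  obtain ⟨δ, hδ, h⟩ := hg ε hε
  refine ⟨δ, hδ, fun E hE hEδ => ?_⟩
  refine lt_of_eq_of_lt (Finset.sum_congr rfl fun i hi => ?_) (h E hE hEδ)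
  rw [hfg (hE.1 i hi).1, hfg (hE.1 i hi).2]

lemma absolutelyContinuousOnInterval_const (a b : ℝ) (c : ℂ) :
    AbsolutelyContinuousOnInterval (fun _ : ℝ => c) a b :=
  ((LipschitzWith.const c).lipschitzOnWith (s := Set.uIcc a b)).absolutelyContinuousOnInterval

lemma absolutelyContinuousOnInterval_ofReal {f : ℝ → ℝ} {a b : ℝ}
    (hf : AbsolutelyContinuousOnInterval f a b) (c : ℂ) :
    AbsolutelyContinuousOnInterval (fun t => (f t : ℂ) * c) a b := by
  have h := hf.fun_smul (absolutelyContinuousOnInterval_const a b c)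
  simpa using h

lemma absolutelyContinuousOnInterval_primitive {f : ℝ → ℂ} {a b : ℝ}
    (hf : IntervalIntegrable f volume a b) :
    AbsolutelyContinuousOnInterval (fun x => ∫ t in a..x, f t) a b := by
  have hre : IntervalIntegrable (fun t => (f t).re) volume a b := ⟨hf.1.re, hf.2.re⟩
  have him : IntervalIntegrable (fun t => (f t).im) volume a b := ⟨hf.1.im, hf.2.im⟩
  have h := (absolutelyContinuousOnInterval_ofReal
    (hre.absolutelyContinuousOnInterval_intervalIntegral Set.left_mem_uIcc) 1).fun_add
    (absolutelyContinuousOnInterval_ofReal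
      (him.absolutelyContinuousOnInterval_intervalIntegral Set.left_mem_uIcc) Complex.I)
  refine absolutelyContinuousOnInterval_congr ?_ h
  intro x hx
  have hfx : IntervalIntegrable f volume a x :=
    hf.mono_set (Set.uIcc_subset_uIcc Set.left_mem_uIcc hx)
  have h1 : ∫ t in a..x, (f t).re = (∫ t in a..x, f t).re :=
    Complex.reCLM.intervalIntegral_comp_comm hfx
  have h2 : ∫ t in a..x, (f t).im = (∫ t in a..x, f t).im :=
    Complex.imCLM.intervalIntegral_comp_comm hfx
  simp only [h1, h2, mul_one]
  exact (Complex.re_add_im _).symm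

/-- Subtracting the primitive of the derivative leaves an absolutely continuous function whose
derivative vanishes almost everywhere, hence a constant. -/
lemma integral_deriv_eq_sub_of_ac {f : ℝ → ℂ} {a b : ℝ}
    (hf : AbsolutelyContinuousOnInterval f a b) (hd : IntervalIntegrable (deriv f) volume a b) :
    ∫ t in a..b, deriv f t = f b - f a := by
  have hac : AbsolutelyContinuousOnInterval (fun x => f x - ∫ t in a..x, deriv f t) a b :=
    hf.fun_sub (absolutelyContinuousOnInterval_primitive hd)
  have hz : ∀ᵐ x, x ∈ Set.uIcc a b →
      HasDerivAt (fun x => f x - ∫ t in a..x, deriv f t) 0 x := by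
    filter_upwards [hf.boundedVariationOn.ae_differentiableAt_of_mem_uIcc,
      hd.ae_hasDerivAt_integral] with x h1 h2 hx
    exact ((h1 hx).hasDerivAt.sub (h2 hx a Set.left_mem_uIcc)).congr_deriv (sub_self _)
  obtain ⟨C, hC⟩ := hac.const_of_ae_hasDerivAt_zero hz
  have ha := hC a Set.left_mem_uIcc
  have hb := hC b Set.right_mem_uIcc
  rw [intervalIntegral.integral_same, sub_zero] at ha
  rw [ha, ← hb, sub_sub_cancel]

/-- Integration by parts for absolutely continuous complex functions. -/
lemma integral_deriv_mul_add_mul_deriv_of_ac {f g : ℝ → ℂ} {a b : ℝ}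
    (hf : AbsolutelyContinuousOnInterval f a b) (hf' : IntervalIntegrable (deriv f) volume a b)
    (hg : AbsolutelyContinuousOnInterval g a b) (hg' : IntervalIntegrable (deriv g) volume a b) :
    (∫ t in a..b, deriv f t * g t) + ∫ t in a..b, f t * deriv g t = f b * g b - f a * g a := by
  have h1 : IntervalIntegrable (fun t => deriv f t * g t) volume a b :=
    hf'.mul_continuousOn hg.continuousOn
  have h2 : IntervalIntegrable (fun t => f t * deriv g t) volume a b :=
    hg'.continuousOn_mul hf.continuousOn
  have hae : ∀ᵐ t, t ∈ Set.uIoc a b →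
      deriv (fun s => f s * g s) t = deriv f t * g t + f t * deriv g t := by
    filter_upwards [hf.boundedVariationOn.ae_differentiableAt_of_mem_uIcc,
      hg.boundedVariationOn.ae_differentiableAt_of_mem_uIcc] with t hft hgt ht
    have ht' := Set.uIoc_subset_uIcc ht
    exact ((hft ht').hasDerivAt.mul (hgt ht').hasDerivAt).deriv
  have hfg : AbsolutelyContinuousOnInterval (fun s => f s * g s) a b := by
    simpa using hf.fun_smul hg
  rw [← integral_deriv_eq_sub_of_ac hfg, intervalIntegral.integral_congr_ae hae,
    intervalIntegral.integral_add h1 h2]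
  refine (h1.add h2).congr_ae ?_
  rw [EventuallyEq, ae_restrict_iff' measurableSet_uIoc]
  filter_upwards [hae] with t ht htm using (ht htm).symm

lemma deriv_primitive_ae_eq {f : ℝ → ℂ} {a b : ℝ} (hf : IntervalIntegrable f volume a b) :
    ∀ᵐ x, x ∈ Set.uIcc a b → deriv (fun x => ∫ t in a..x, f t) x = f x := by
  filter_upwards [hf.ae_hasDerivAt_integral] with x hx hxm
  exact (hx hxm a Set.left_mem_uIcc).deriv

lemma intervalIntegrable_deriv_primitive {f : ℝ → ℂ} {a b : ℝ}
    (hf : IntervalIntegrable f volume a b) :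
    IntervalIntegrable (deriv fun x => ∫ t in a..x, f t) volume a b := by
  refine hf.congr_ae ?_
  rw [EventuallyEq, ae_restrict_iff' measurableSet_uIoc]
  filter_upwards [deriv_primitive_ae_eq hf] with t ht htm using (ht (Set.uIoc_subset_uIcc htm)).symm

lemma integral_mul_primitive_add {f g : ℝ → ℂ} {a b : ℝ}
    (hf : IntervalIntegrable f volume a b) (hg : IntervalIntegrable g volume a b) :
    (∫ t in a..b, f t * ∫ s in a..t, g s) + ∫ t in a..b, (∫ s in a..t, f s) * g t =
      (∫ t in a..b, f t) * ∫ t in a..b, g t := by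
  have h := integral_deriv_mul_add_mul_deriv_of_ac (absolutelyContinuousOnInterval_primitive hf)
    (intervalIntegrable_deriv_primitive hf) (absolutelyContinuousOnInterval_primitive hg)
    (intervalIntegrable_deriv_primitive hg)
  simp only [intervalIntegral.integral_same, mul_zero, sub_zero] at h
  rw [← h]
  congr 1
  · refine intervalIntegral.integral_congr_ae ?_
    filter_upwards [deriv_primitive_ae_eq hf] with t ht htm
    rw [ht (Set.uIoc_subset_uIcc htm)]
  · refine intervalIntegral.integral_congr_ae ?_
    filter_upwards [deriv_primitive_ae_eq hg] with t ht htm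
    rw [ht (Set.uIoc_subset_uIcc htm)]

/-- The lemma of du Bois-Reymond in `L²`: a function with weak derivative `v` is a primitive of
`v` up to a constant. -/
lemma exists_ae_eq_const_add_primitive {a b : ℝ} (hab : a < b) {u v : ℝ → ℂ}
    (hu : MemLp u 2 (volume.restrict (Set.Icc a b)))
    (hv : MemLp v 2 (volume.restrict (Set.Icc a b)))
    (h : ∀ w : ℝ → ℂ, MemLp w 2 (volume.restrict (Set.Icc a b)) → ∫ t in a..b, w t = 0 →
      ∫ t in a..b, conj (w t) * u t = -∫ t in a..b, conj (∫ s in a..t, w s) * v t) :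
    ∃ c : ℂ, ∀ᵐ t ∂volume.restrict (Set.Icc a b), u t = c + ∫ s in a..t, v s := by
  have toInt : ∀ {f : ℝ → ℂ}, Integrable f (volume.restrict (Set.Icc a b)) →
      IntervalIntegrable f volume a b := fun hf =>
    (intervalIntegrable_iff_integrableOn_Icc_of_le hab.le).2 hf
  have hvi := toInt (hv.integrable one_le_two)
  set G : ℝ → ℂ := fun t => ∫ s in a..t, v s with hG
  have hGc : ContinuousOn G (Set.Icc a b) := by
    rw [← Set.uIcc_of_le hab.le]; exact (absolutelyContinuousOnInterval_primitive hvi).continuousOn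
  have hGm : MemLp G 2 (volume.restrict (Set.Icc a b)) := by
    obtain ⟨C, hC⟩ := isCompact_Icc.exists_bound_of_continuousOn hGc
    refine MemLp.of_bound (hGc.aestronglyMeasurable measurableSet_Icc) C ?_
    exact (ae_restrict_iff' measurableSet_Icc).2 (ae_of_all _ hC)
  -- The mean value of u - G, chosen so that w = u - G - c has mean zero and is itself an admissible
  -- test function.
  set c : ℂ := ((b - a : ℝ) : ℂ)⁻¹ * ∫ t in a..b, (u t - G t) with hc
  set w : ℝ → ℂ := fun t => u t - G t - c with hw
  have hwm : MemLp w 2 (volume.restrict (Set.Icc a b)) := (hu.sub hGm).sub (memLp_const c)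
  have hwi := toInt (hwm.integrable one_le_two)
  have hba : ((b - a : ℝ) : ℂ) ≠ 0 := by exact_mod_cast (sub_pos.2 hab).ne'
  have hw0 : ∫ t in a..b, w t = 0 := by
    have hi : IntervalIntegrable (fun t => u t - G t) volume a b :=
      toInt ((hu.sub hGm).integrable one_le_two)
    simp only [hw]
    rw [intervalIntegral.integral_sub hi
      intervalIntegrable_const, intervalIntegral.integral_const, hc, Complex.real_smul,
      mul_inv_cancel_left₀ hba, sub_self]
  have hcw : MemLp (fun t => conj (w t)) 2 (volume.restrict (Set.Icc a b)) := hwm.star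
  have hcwi := toInt (hcw.integrable one_le_two)
  have hcw0 : ∫ t in a..b, conj (w t) = 0 := by
    rw [intervalIntegral.intervalIntegral_conj, hw0, map_zero]
  have e1 := h w hwm hw0
  -- The boundary term vanishes because conj w has mean zero. Comparison with `e1` shows that w is
  -- orthogonal to u - G and, having mean zero, to c; so w is orthogonal to itself.
  have e2 := integral_mul_primitive_add hcwi hvi
  rw [hcw0, zero_mul] at e2
  simp only [intervalIntegral.intervalIntegral_conj] at e2
  have i1 : IntervalIntegrable (fun t => conj (w t) * u t) volume a b := toInt (hcw.integrable_mul hu)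
  have i2 : IntervalIntegrable (fun t => conj (w t) * G t) volume a b :=
    toInt (hcw.integrable_mul hGm)
  have e3 : ∫ t in a..b, conj (w t) * w t = 0 := by
    have : ∀ t, conj (w t) * w t = conj (w t) * u t - conj (w t) * G t - conj (w t) * c :=
      fun t => by simp only [hw]; ring
    simp_rw [this]
    rw [intervalIntegral.integral_sub (i1.sub i2) (hcwi.mul_const c),
      intervalIntegral.integral_sub i1 i2, intervalIntegral.integral_mul_const, hcw0, e1]
    linear_combination -e2
  have e4 : ∫ t in Set.Icc a b, ‖w t‖ ^ 2 = 0 := by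
    have h1 : ∀ t, conj (w t) * w t = ((‖w t‖ ^ 2 : ℝ) : ℂ) := fun t => by
      rw [Complex.conj_mul']; push_cast; rfl
    simp_rw [h1] at e3
    rw [intervalIntegral.integral_ofReal, intervalIntegral.integral_of_le hab.le,
      ← integral_Icc_eq_integral_Ioc] at e3
    exact_mod_cast e3
  have e5 := (integral_eq_zero_iff_of_nonneg (fun t => by positivity)
    ((memLp_two_iff_integrable_sq_norm hwm.1).1 hwm)).1 e4
  refine ⟨c, ?_⟩
  filter_upwards [e5] with t ht
  have h1 : w t = 0 := by simpa using ht
  simp only [hw] at h1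
  linear_combination h1

end AbsolutelyContinuous

/-! ### Fourier transforms of derivatives and translates -/

section FourierDerivative

open ComplexConjugate

lemma integral_exp_mul_deriv {a b : ℝ} {f : ℝ → ℂ}
    (hf : AbsolutelyContinuousOnInterval f a b) (hf' : IntervalIntegrable (deriv f) volume a b)
    (ha : f a = 0) (hb : f b = 0) (x : ℝ) :
    ∫ t in a..b, Complex.exp (-(Complex.I * x * t)) * deriv f t =
      Complex.I * x * ∫ t in a..b, Complex.exp (-(Complex.I * x * t)) * f t := by
  have hd : ∀ t : ℝ, HasDerivAt (fun t : ℝ => Complex.exp (-(Complex.I * x * t)))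
      (Complex.exp (-(Complex.I * x * t)) * -(Complex.I * x)) t := fun t => by
    have h1 : HasDerivAt (fun t : ℝ => -(Complex.I * x * (t : ℂ))) (-(Complex.I * x)) t :=
      ((hasDerivAt_id t).ofReal_comp.const_mul (Complex.I * x)).neg.congr_deriv (by simp)
    exact h1.cexp
  have hderiv : deriv (fun t : ℝ => Complex.exp (-(Complex.I * x * t))) =
      fun t : ℝ => Complex.exp (-(Complex.I * x * t)) * -(Complex.I * x) :=
    funext fun t => (hd t).deriv
  have hac : AbsolutelyContinuousOnInterval
      (fun t : ℝ => Complex.exp (-(Complex.I * x * t))) a b := by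
    apply ContDiffOn.absolutelyContinuousOnInterval
    exact (contDiff_const.mul Complex.ofRealCLM.contDiff).neg.cexp.contDiffOn
  have hi : IntervalIntegrable (deriv fun t : ℝ => Complex.exp (-(Complex.I * x * t)))
      volume a b := by
    rw [hderiv]
    exact Continuous.intervalIntegrable (by fun_prop) _ _
  have h := integral_deriv_mul_add_mul_deriv_of_ac hac hi hf hf'
  rw [ha, hb, mul_zero, mul_zero, sub_zero, hderiv] at h
  rw [← intervalIntegral.integral_const_mul, eq_neg_of_add_eq_zero_right h,
    ← intervalIntegral.integral_neg]
  exact intervalIntegral.integral_congr fun t _ => by ring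

lemma integrable_of_ae_eq_indicator {h : L2R} {a b : ℝ} {f : ℝ → ℂ}
    (hh : h =ᵐ[volume] (Set.Icc a b).indicator f) : Integrable h :=
  integrable_of_ae_eq_zero h (a := a) (b := b) (by
    filter_upwards [hh] with t ht htm
    rw [ht, Set.indicator_of_notMem htm])

lemma integral_mul_ae_eq_indicator {h : L2R} {a b : ℝ} (hab : a ≤ b) {f : ℝ → ℂ}
    (hh : h =ᵐ[volume] (Set.Icc a b).indicator f) (e : ℝ → ℂ) :
    ∫ t, e t * h t = ∫ t in a..b, e t * f t := by
  rw [intervalIntegral.integral_of_le hab, ← integral_Icc_eq_integral_Ioc,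
    ← integral_indicator measurableSet_Icc]
  apply integral_congr_ae
  filter_upwards [hh] with t ht
  by_cases htm : t ∈ Set.Icc a b
  · simp only [ht, Set.indicator_of_mem htm]
  · simp only [ht, Set.indicator_of_notMem htm, mul_zero]

/-- The Fourier-Plancherel transform of the derivative of an absolutely continuous function
vanishing at the end points of an interval. -/
lemma fourierPlancherel_deriv {a b : ℝ} (hab : a ≤ b) {f : ℝ → ℂ}
    (hf : AbsolutelyContinuousOnInterval f a b) (hf' : IntervalIntegrable (deriv f) volume a b)
    (ha : f a = 0) (hb : f b = 0) {h w : L2R} (hh : h =ᵐ[volume] (Set.Icc a b).indicator f)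
    (hw : w =ᵐ[volume] (Set.Icc a b).indicator (deriv f)) :
    fourierPlancherel w =ᵐ[volume] fun x : ℝ => Complex.I * x * fourierPlancherel h x := by
  filter_upwards [fourierPlancherel_ae_eq h (integrable_of_ae_eq_indicator hh),
    fourierPlancherel_ae_eq w (integrable_of_ae_eq_indicator hw)] with x h1 h2
  rw [h1, h2, integral_mul_ae_eq_indicator hab hh, integral_mul_ae_eq_indicator hab hw,
    integral_exp_mul_deriv hf hf' ha hb]
  ring

/-- Translation multiplies the transform by a factor of modulus one. Only the modulus is kept, since
it decides integrability. -/
lemma norm_fourierPlancherel_translate {h k : L2R} (hi : Integrable h) (ki : Integrable k) (a : ℝ)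
    (hk : k =ᵐ[volume] fun t => h (t + a)) :
    ∀ᵐ x, ‖fourierPlancherel k x‖ = ‖fourierPlancherel h x‖ := by
  filter_upwards [fourierPlancherel_ae_eq h hi, fourierPlancherel_ae_eq k ki] with x h1 h2
  have h3 : ∫ t : ℝ, Complex.exp (-(Complex.I * x * t)) * k t =
      Complex.exp (Complex.I * x * a) * ∫ t : ℝ, Complex.exp (-(Complex.I * x * t)) * h t := by
    rw [← integral_const_mul, ← integral_add_right_eq_self (fun t : ℝ =>
      Complex.exp (Complex.I * x * a) * (Complex.exp (-(Complex.I * x * t)) * h t)) a]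
    apply integral_congr_ae
    filter_upwards [hk] with t ht
    rw [ht, ← mul_assoc, ← Complex.exp_add]
    congr 2
    push_cast
    ring
  have h4 : ‖Complex.exp (Complex.I * x * a)‖ = 1 := by
    rw [mul_assoc, mul_comm, ← Complex.ofReal_mul]; exact Complex.norm_exp_ofReal_mul_I _
  rw [h1, h2, h3, norm_mul, norm_mul, norm_mul, h4, one_mul]

end FourierDerivative

/-! ### Zero extension and the Dirichlet operator on the Fourier side -/

section Interval

variable {ℓ : ℝ}

lemma coeFn_extendZero (φ : L2I ℓ) : extendZero ℓ φ =ᵐ[volume] (Set.Icc 0 ℓ).indicator φ := by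
  have h : extendZero ℓ φ = ((memLp_indicator_iff_restrict measurableSet_Icc).2
    (Lp.memLp φ)).toLp ((Set.Icc 0 ℓ).indicator φ) := rfl
  rw [h]
  exact MemLp.coeFn_toLp _

lemma extendZero_ae_eq_restrict (φ : L2I ℓ) :
    extendZero ℓ φ =ᵐ[volume.restrict (Set.Icc 0 ℓ)] φ := by
  filter_upwards [ae_restrict_of_ae (coeFn_extendZero φ), ae_restrict_mem measurableSet_Icc]
    with t h1 h2
  rw [h1, Set.indicator_of_mem h2]

lemma exists_extendZero_eq_translate {h : L2R} {a : ℝ}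
    (h0 : ∀ᵐ t, t ∉ Set.Icc a (a + ℓ) → h t = 0) :
    ∃ χ : L2I ℓ, extendZero ℓ χ =ᵐ[volume] fun t => h (t + a) := by
  have hmp : MeasurePreserving (fun t : ℝ => t + a) := measurePreserving_add_right volume a
  have hm : MemLp (fun t => h (t + a)) 2 := (Lp.memLp h).comp_measurePreserving hmp
  refine ⟨(hm.restrict (Set.Icc 0 ℓ)).toLp _, ?_⟩
  filter_upwards [coeFn_extendZero ((hm.restrict (Set.Icc 0 ℓ)).toLp _),
    (ae_restrict_iff' measurableSet_Icc).1 (hm.restrict (Set.Icc 0 ℓ)).coeFn_toLp,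
    hmp.quasiMeasurePreserving.ae h0] with t h1 h2 h3
  rw [h1]
  by_cases ht : t ∈ Set.Icc 0 ℓ
  · rw [Set.indicator_of_mem ht, h2 ht]
  · rw [Set.indicator_of_notMem ht, h3]
    exact fun h4 => ht ⟨by linarith [h4.1], by linarith [h4.2]⟩

/-- The operator is defined through a chosen representative; independence of the choice allows
computing with any given one. -/
lemma dirichletMomentum_ae_eq {φ : L2I ℓ} {g : ℝ → ℂ} (hg : IsDirichletRep ℓ φ g) :
    dirichletMomentum ℓ ⟨φ, g, hg⟩ =ᵐ[volume.restrict (Set.Icc 0 ℓ)]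
      fun t => -Complex.I * deriv g t := by
  have hφ : ∃ g, IsDirichletRep ℓ φ g := ⟨g, hg⟩
  have h1 : dirichletMomentum ℓ ⟨φ, g, hg⟩ =
      (-Complex.I) • (hφ.choose_spec.memLp_deriv).toLp (deriv hφ.choose) := rfl
  rw [h1]
  filter_upwards [Lp.coeFn_smul (-Complex.I) ((hφ.choose_spec.memLp_deriv).toLp (deriv hφ.choose)),
    (hφ.choose_spec.memLp_deriv).coeFn_toLp, hφ.choose_spec.deriv_ae_eq hg] with t a1 a2 a3
  rw [a1, Pi.smul_apply, a2, a3, smul_eq_mul]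

/-- The Fourier-Plancherel transform turns `dirichletMomentum` into multiplication by `x`. -/
lemma fourierPlancherel_dirichletMomentum (hℓ : 0 < ℓ) (φ : (dirichletMomentum ℓ).domain) :
    fourierPlancherel (extendZero ℓ (dirichletMomentum ℓ φ)) =ᵐ[volume]
      fun x : ℝ => (x : ℂ) * fourierPlancherel (extendZero ℓ (φ : L2I ℓ)) x := by
  obtain ⟨φ, g, hg⟩ := φ
  have hd : IntervalIntegrable (deriv g) volume 0 ℓ :=
    (intervalIntegrable_iff_integrableOn_Icc_of_le hℓ.le).2 (hg.memLp_deriv.integrable one_le_two)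
  have hh : extendZero ℓ φ =ᵐ[volume] (Set.Icc 0 ℓ).indicator g := by
    filter_upwards [coeFn_extendZero φ, (ae_restrict_iff' measurableSet_Icc).1 hg.ae_eq]
      with t h1 h2
    rw [h1]
    by_cases ht : t ∈ Set.Icc 0 ℓ <;> simp [ht, h2]
  -- Multiplying by i turns P₀φ into φ', to which the derivative rule applies; the factor i cancels
  -- at the end.
  have hw : (Complex.I • extendZero ℓ (dirichletMomentum ℓ ⟨φ, g, hg⟩) : L2R) =ᵐ[volume]
      (Set.Icc 0 ℓ).indicator (deriv g) := by
    filter_upwards [Lp.coeFn_smul Complex.I (extendZero ℓ (dirichletMomentum ℓ ⟨φ, g, hg⟩)),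
      coeFn_extendZero (dirichletMomentum ℓ ⟨φ, g, hg⟩),
      (ae_restrict_iff' measurableSet_Icc).1 (dirichletMomentum_ae_eq hg)] with t h1 h2 h3
    rw [h1, Pi.smul_apply, h2]
    by_cases ht : t ∈ Set.Icc 0 ℓ
    · rw [Set.indicator_of_mem ht, Set.indicator_of_mem ht, h3 ht, smul_eq_mul, ← mul_assoc]
      simp
    · simp [ht]
  have h := fourierPlancherel_deriv hℓ.le hg.ac hd hg.zero_left hg.zero_right hh hw
  rw [map_smul] at h
  filter_upwards [h, Lp.coeFn_smul Complex.I
    (fourierPlancherel (extendZero ℓ (dirichletMomentum ℓ ⟨φ, g, hg⟩)))] with x h1 h2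
  rw [h2, Pi.smul_apply, smul_eq_mul, mul_assoc] at h1
  exact mul_left_cancel₀ Complex.I_ne_zero h1

end Interval

/-! ### Weak limits by Banach–Steinhaus and Riesz -/

section WeakLimit

/-- A weakly convergent sequence of vectors of a Hilbert space has a weak limit. -/
lemma exists_inner_eq_of_tendsto {H : Type*} [NormedAddCommGroup H] [InnerProductSpace ℂ H]
    [CompleteSpace H] {v : ℕ → H} {L : H → ℂ}
    (h : ∀ x, Tendsto (fun k => ⟪v k, x⟫_ℂ) atTop (𝓝 (L x))) : ∃ w : H, ∀ x, ⟪w, x⟫_ℂ = L x := by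
  have ht : Tendsto (fun k x => (innerSL ℂ (v k)) x) atTop (𝓝 L) := tendsto_pi_nhds.2 h
  -- Boundedness of the pointwise limit is the Banach–Steinhaus theorem; Riesz representation then
  -- supplies w.
  let T : H →L[ℂ] ℂ := continuousLinearMapOfTendsto (fun k => innerSL ℂ (v k)) ht
  refine ⟨(InnerProductSpace.toDual ℂ H).symm T, fun x => ?_⟩
  rw [InnerProductSpace.toDual_symm_apply]
  rfl

/-- A function whose products with the range of `T` are integrable pairs with it as a vector. -/
lemma exists_inner_eq_integral (T : L2R →L[ℂ] L2R) {f : ℝ → ℂ} (hf : ∀ k : ℕ,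
    MemLp ((Set.Icc (-k : ℝ) k).indicator f) 2 volume)
    (hint : ∀ h, Integrable fun x => ⟪f x, T h x⟫_ℂ) :
    ∃ v : L2R, ∀ h, ⟪v, h⟫_ℂ = ∫ x, ⟪f x, T h x⟫_ℂ := by
  -- The truncations of f to [-k, k] are square integrable, so each pairs as a vector. Dominated
  -- convergence gives weak convergence of their images under the adjoint of T.
  refine exists_inner_eq_of_tendsto
    (v := fun k => ContinuousLinearMap.adjoint T ((hf k).toLp _)) fun h => ?_
  have h1 : ∀ k, ⟪ContinuousLinearMap.adjoint T ((hf k).toLp _), h⟫_ℂ =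
      ∫ x, (Set.Icc (-k : ℝ) k).indicator (fun x => ⟪f x, T h x⟫_ℂ) x := fun k => by
    rw [ContinuousLinearMap.adjoint_inner_left, L2.inner_def]
    apply integral_congr_ae
    filter_upwards [(hf k).coeFn_toLp] with x hx
    rw [hx]
    by_cases hm : x ∈ Set.Icc (-k : ℝ) k <;> simp [hm]
  simp_rw [h1]
  refine tendsto_integral_of_dominated_convergence (fun x => ‖⟪f x, T h x⟫_ℂ‖)
    (fun k => ((hint h).indicator measurableSet_Icc).aestronglyMeasurable) (hint h).norm
    (fun k => ae_of_all _ fun x => ?_) (ae_of_all _ fun x => ?_)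
  · exact norm_indicator_le_norm_self _ _
  · refine tendsto_const_nhds.congr' ?_
    filter_upwards [eventually_ge_atTop ⌈|x|⌉₊] with k hk
    have h2 : |x| ≤ k := (Nat.le_ceil _).trans (by exact_mod_cast hk)
    rw [Set.indicator_of_mem (Set.mem_Icc.2 (abs_le.1 h2))]

end WeakLimit

/-! ### Weak integrability of x forces the Dirichlet domain -/

section WeakMoment

open ComplexConjugate

variable {ℓ : ℝ}

/-- `xⁿ` is integrable with respect to all the complex measures `⟪χ, P(·) φ⟫`. -/
def WeaklyIntegrable (ℓ : ℝ) (n : ℕ) (φ : L2I ℓ) : Prop :=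
  ∀ χ : L2I ℓ, Integrable fun x : ℝ => ⟪fourierPlancherel (extendZero ℓ χ) x,
    (x : ℂ) ^ n * fourierPlancherel (extendZero ℓ φ) x⟫_ℂ

lemma aestronglyMeasurable_pow_mul (n : ℕ) (ψ : L2R) :
    AEStronglyMeasurable (fun x : ℝ => (x : ℂ) ^ n * ψ x) volume :=
  ((Complex.continuous_ofReal.pow n).aestronglyMeasurable).mul (Lp.aestronglyMeasurable ψ)

lemma chiMul_congr {X Y : Set ℝ} (h : X = Y) (hX : MeasurableSet X) (hY : MeasurableSet Y) :
    chiMul X hX = chiMul Y hY := by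
  subst h; rfl

lemma chiMul_ae_eq_zero (X : Set ℝ) (hX : MeasurableSet X) {a b : ℝ} (hXab : X ⊆ Set.Icc a b)
    (h : L2R) : ∀ᵐ t, t ∉ Set.Icc a b → chiMul X hX h t = 0 := by
  filter_upwards [coeFn_chiMul X hX h] with t ht htm
  rw [ht, Set.indicator_of_notMem fun h => htm (hXab h)]

lemma extendZero_eq_zero_ae (φ : L2I ℓ) : ∀ᵐ t, t ∉ Set.Icc 0 ℓ → extendZero ℓ φ t = 0 := by
  filter_upwards [coeFn_extendZero φ] with t ht htm
  rw [ht, Set.indicator_of_notMem htm]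

/-- Moving the support back to [0, ℓ] preserves the modulus of the transform, so the hypothesis on
functions from L²([0, ℓ]) covers every interval of length ℓ. -/
lemma integrable_of_translate {n : ℕ} {φ : L2I ℓ} (hφ : WeaklyIntegrable ℓ n φ) {a : ℝ} {h : L2R}
    (h0 : ∀ᵐ t, t ∉ Set.Icc a (a + ℓ) → h t = 0) :
    Integrable fun x : ℝ => ⟪(x : ℂ) ^ n * fourierPlancherel (extendZero ℓ φ) x,
      fourierPlancherel h x⟫_ℂ := by
  obtain ⟨χ, hχ⟩ := exists_extendZero_eq_translate h0
  have hn := norm_fourierPlancherel_translate (integrable_of_ae_eq_zero h h0)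
    (integrable_of_ae_eq_zero _ (extendZero_eq_zero_ae χ)) a hχ
  refine (hφ χ).mono ((aestronglyMeasurable_pow_mul n _).inner (Lp.aestronglyMeasurable _)) ?_
  filter_upwards [hn] with x hx
  simp only [RCLike.inner_apply, norm_mul, RCLike.norm_conj, hx]
  exact (mul_comm _ _).le

/-- The interval [-ℓ, 2ℓ] is cut into three pieces of length ℓ. The room on both sides of [0, ℓ] is
what later yields the boundary conditions. -/
lemma integrable_inner_fourierPlancherel_chiMul (hℓ : 0 < ℓ) {n : ℕ} {φ : L2I ℓ}
    (hφ : WeaklyIntegrable ℓ n φ) (h : L2R) :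
    Integrable fun x : ℝ => ⟪(x : ℂ) ^ n * fourierPlancherel (extendZero ℓ φ) x,
      fourierPlancherel (chiMul (Set.Icc (-ℓ) (2 * ℓ)) measurableSet_Icc h) x⟫_ℂ := by
  have m1 : MeasurableSet (Set.Ico (-ℓ) 0) := measurableSet_Ico
  have m2 : MeasurableSet (Set.Ico 0 ℓ) := measurableSet_Ico
  have m3 : MeasurableSet (Set.Icc ℓ (2 * ℓ)) := measurableSet_Icc
  have hU : Set.Icc (-ℓ) (2 * ℓ) = (Set.Ico (-ℓ) 0 ∪ Set.Ico 0 ℓ) ∪ Set.Icc ℓ (2 * ℓ) := by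
    rw [Set.Ico_union_Ico_eq_Ico (by linarith) hℓ.le, Set.Ico_union_Icc_eq_Icc (by linarith)
      (by linarith)]
  have hsplit : chiMul (Set.Icc (-ℓ) (2 * ℓ)) measurableSet_Icc h =
      chiMul _ m1 h + chiMul _ m2 h + chiMul _ m3 h := by
    have d1 : Disjoint (Set.Ico (-ℓ) 0) (Set.Ico 0 ℓ) :=
      Set.disjoint_left.2 fun t h1 h2 => by linarith [h1.2, h2.1]
    have d2 : Disjoint (Set.Ico (-ℓ) 0 ∪ Set.Ico 0 ℓ) (Set.Icc ℓ (2 * ℓ)) := by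
      rw [Set.Ico_union_Ico_eq_Ico (by linarith) hℓ.le]
      exact Set.disjoint_left.2 fun t h1 h2 => by linarith [h1.2, h2.1]
    rw [chiMul_congr hU measurableSet_Icc ((m1.union m2).union m3), chiMul_union (m1.union m2) m3 d2,
      chiMul_union m1 m2 d1]
  have i1 := integrable_of_translate hφ (a := -ℓ) (chiMul_ae_eq_zero _ m1
    (by rw [neg_add_cancel]; exact Set.Ico_subset_Icc_self) h)
  have i2 := integrable_of_translate hφ (a := 0) (chiMul_ae_eq_zero _ m2
    (by rw [zero_add]; exact Set.Ico_subset_Icc_self) h)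
  have i3 := integrable_of_translate hφ (a := ℓ) (chiMul_ae_eq_zero _ m3
    (by rw [two_mul]) h)
  rw [hsplit, map_add, map_add]
  refine ((i1.add i2).add i3).congr ?_
  filter_upwards [Lp.coeFn_add (fourierPlancherel (chiMul _ m1 h) +
      fourierPlancherel (chiMul _ m2 h)) (fourierPlancherel (chiMul _ m3 h)),
    Lp.coeFn_add (fourierPlancherel (chiMul _ m1 h)) (fourierPlancherel (chiMul _ m2 h))]
    with x h1 h2
  simp only [Pi.add_apply] at h1 h2 ⊢
  rw [h1, h2, inner_add_right, inner_add_right]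

lemma memLp_indicator_pow_mul (n k : ℕ) (ψ : L2R) :
    MemLp ((Set.Icc (-k : ℝ) k).indicator fun x : ℝ => (x : ℂ) ^ n * ψ x) 2 volume := by
  refine MemLp.of_le_mul (c := (k : ℝ) ^ n) (Lp.memLp ψ)
    ((aestronglyMeasurable_pow_mul n ψ).indicator measurableSet_Icc) (ae_of_all _ fun x => ?_)
  by_cases hx : x ∈ Set.Icc (-k : ℝ) k
  · rw [Set.indicator_of_mem hx, norm_mul, norm_pow, Complex.norm_real]
    gcongr
    exact abs_le.2 hx
  · rw [Set.indicator_of_notMem hx, norm_zero]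
    positivity

/-- The weak derivative of the zero extension of `φ` is square integrable near `[0, ℓ]`. -/
lemma exists_weak_derivative (hℓ : 0 < ℓ) {φ : L2I ℓ} (hφ : WeaklyIntegrable ℓ 1 φ) :
    ∃ v : L2R, ∀ w : ℝ → ℂ, MemLp w 2 (volume.restrict (Set.Icc (-ℓ) (2 * ℓ))) →
      ∫ t in (-ℓ)..(2 * ℓ), w t = 0 → ∫ t in (-ℓ)..(2 * ℓ), conj (w t) * extendZero ℓ φ t =
        -∫ t in (-ℓ)..(2 * ℓ), conj (∫ s in (-ℓ)..t, w s) * (Complex.I * v t) := by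
  obtain ⟨v, hv⟩ := exists_inner_eq_integral
    (fourierPlancherel.toContinuousLinearMap ∘L chiMul (Set.Icc (-ℓ) (2 * ℓ)) measurableSet_Icc)
    (fun k => memLp_indicator_pow_mul 1 k (fourierPlancherel (extendZero ℓ φ)))
    (integrable_inner_fourierPlancherel_chiMul hℓ hφ)
  refine ⟨v, fun w hw hw0 => ?_⟩
  have hab : -ℓ ≤ 2 * ℓ := by linarith
  have hwi : IntervalIntegrable w volume (-ℓ) (2 * ℓ) :=
    (intervalIntegrable_iff_integrableOn_Icc_of_le hab).2 (hw.integrable one_le_two)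
  -- The actual test function is this primitive of w. It vanishes at both end points, on the right
  -- because w has mean zero, so the transform of w is ix times that of f.
  set f : ℝ → ℂ := fun t => ∫ s in (-ℓ)..t, w s with hf
  have hac : AbsolutelyContinuousOnInterval f (-ℓ) (2 * ℓ) :=
    absolutelyContinuousOnInterval_primitive hwi
  have hfc : ContinuousOn f (Set.Icc (-ℓ) (2 * ℓ)) := by
    rw [← Set.uIcc_of_le hab]; exact hac.continuousOn
  have hfm : MemLp f 2 (volume.restrict (Set.Icc (-ℓ) (2 * ℓ))) := by
    obtain ⟨C, hC⟩ := isCompact_Icc.exists_bound_of_continuousOn hfc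
    refine MemLp.of_bound (hfc.aestronglyMeasurable measurableSet_Icc) C ?_
    exact (ae_restrict_iff' measurableSet_Icc).2 (ae_of_all _ hC)
  have hfm' := (memLp_indicator_iff_restrict measurableSet_Icc).2 hfm
  have hwm' := (memLp_indicator_iff_restrict measurableSet_Icc).2 hw
  have hh := hfm'.coeFn_toLp
  have hW := hwm'.coeFn_toLp
  set h : L2R := hfm'.toLp _
  set W : L2R := hwm'.toLp _
  have hWd : W =ᵐ[volume] (Set.Icc (-ℓ) (2 * ℓ)).indicator (deriv f) := by
    filter_upwards [hW, deriv_primitive_ae_eq hwi] with t h1 h2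
    rw [h1]
    by_cases ht : t ∈ Set.Icc (-ℓ) (2 * ℓ)
    · rw [Set.indicator_of_mem ht, Set.indicator_of_mem ht, h2 (by rwa [Set.uIcc_of_le hab])]
    · rw [Set.indicator_of_notMem ht, Set.indicator_of_notMem ht]
  have hF := fourierPlancherel_deriv hab hac (intervalIntegrable_deriv_primitive hwi)
    intervalIntegral.integral_same hw0 hh hWd
  have hchi : chiMul (Set.Icc (-ℓ) (2 * ℓ)) measurableSet_Icc h = h := by
    apply Lp.ext
    filter_upwards [coeFn_chiMul (Set.Icc (-ℓ) (2 * ℓ)) measurableSet_Icc h, hh] with t h1 h2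
    rw [h1]
    by_cases ht : t ∈ Set.Icc (-ℓ) (2 * ℓ)
    · rw [Set.indicator_of_mem ht]
    · rw [Set.indicator_of_notMem ht, h2, Set.indicator_of_notMem ht]
  -- By Plancherel, pairing with W is pairing the transform of the extension with ix times that of
  -- h; the factor x moves to the other side and defines v.
  have key : ⟪extendZero ℓ φ, W⟫_ℂ = Complex.I * ⟪v, h⟫_ℂ := by
    rw [← fourierPlancherel.inner_map_map, hv, L2.inner_def, ← integral_const_mul]
    apply integral_congr_ae
    filter_upwards [hF] with x hx
    rw [hx]
    simp only [ContinuousLinearMap.comp_apply, hchi, LinearIsometry.coe_toContinuousLinearMap,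
      RCLike.inner_apply, map_mul, pow_one, Complex.conj_ofReal]
    ring
  have key2 : ⟪W, extendZero ℓ φ⟫_ℂ = -(Complex.I * ⟪h, v⟫_ℂ) := by
    rw [← inner_conj_symm, key, map_mul, inner_conj_symm, Complex.conj_I, neg_mul]
  have e1 : ∀ {k : L2R} {p : ℝ → ℂ}, k =ᵐ[volume] (Set.Icc (-ℓ) (2 * ℓ)).indicator p → ∀ u : L2R,
      ⟪k, u⟫_ℂ = ∫ t in (-ℓ)..(2 * ℓ), conj (p t) * u t := by
    intro k p hk u
    rw [L2.inner_def, intervalIntegral.integral_of_le hab, ← integral_Icc_eq_integral_Ioc,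
      ← integral_indicator measurableSet_Icc]
    apply integral_congr_ae
    filter_upwards [hk] with t ht
    rw [ht, RCLike.inner_apply]
    by_cases htm : t ∈ Set.Icc (-ℓ) (2 * ℓ)
    · rw [Set.indicator_of_mem htm, Set.indicator_of_mem htm, mul_comm]
    · rw [Set.indicator_of_notMem htm, Set.indicator_of_notMem htm, map_zero, mul_zero]
  rw [← e1 hW, key2, e1 hh, ← intervalIntegral.integral_const_mul]
  congr 1
  exact intervalIntegral.integral_congr fun t _ => by ring

lemma eqOn_zero_of_ae_eq_zero {a b : ℝ} (hab : a < b) {g : ℝ → ℂ}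
    (hg : ContinuousOn g (Set.Icc a b)) (h0 : ∀ᵐ t, t ∈ Set.Ioo a b → g t = 0) :
    Set.EqOn g 0 (Set.Icc a b) := by
  have h1 : Set.EqOn g 0 (Set.Ioo a b) :=
    Measure.eqOn_open_of_ae_eq ((ae_restrict_iff' measurableSet_Ioo).2 h0) isOpen_Ioo
      (hg.mono Set.Ioo_subset_Icc_self) continuousOn_const
  exact h1.of_subset_closure hg continuousOn_const Set.Ioo_subset_Icc_self
    (closure_Ioo hab.ne).ge

/-- If `x` is weakly integrable, then `φ` is in the domain of `dirichletMomentum`. -/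
lemma WeaklyIntegrable.mem_domain (hℓ : 0 < ℓ) {φ : L2I ℓ} (hφ : WeaklyIntegrable ℓ 1 φ) :
    φ ∈ (dirichletMomentum ℓ).domain := by
  obtain ⟨v, hv⟩ := exists_weak_derivative hℓ hφ
  have hab : -ℓ ≤ 2 * ℓ := by linarith
  have hvm : MemLp (fun t => Complex.I * v t) 2 (volume.restrict (Set.Icc (-ℓ) (2 * ℓ))) :=
    ((Lp.memLp v).const_mul Complex.I).restrict _
  have hvi : IntervalIntegrable (fun t => Complex.I * v t) volume (-ℓ) (2 * ℓ) :=
    (intervalIntegrable_iff_integrableOn_Icc_of_le hab).2 (hvm.integrable one_le_two)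
  obtain ⟨c, hc⟩ := exists_ae_eq_const_add_primitive (by linarith)
    ((Lp.memLp (extendZero ℓ φ)).restrict _) hvm hv
  rw [ae_restrict_iff' measurableSet_Icc] at hc
  set g : ℝ → ℂ := fun t => c + ∫ s in (-ℓ)..t, Complex.I * v s with hg
  have hac : AbsolutelyContinuousOnInterval g (-ℓ) (2 * ℓ) :=
    (absolutelyContinuousOnInterval_const _ _ c).fun_add
      (absolutelyContinuousOnInterval_primitive hvi)
  have hgc : ContinuousOn g (Set.Icc (-ℓ) (2 * ℓ)) := by
    rw [← Set.uIcc_of_le hab]; exact hac.continuousOn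
  have hout : ∀ᵐ t, t ∈ Set.Icc (-ℓ) (2 * ℓ) → t ∉ Set.Icc 0 ℓ → g t = 0 := by
    filter_upwards [hc, extendZero_eq_zero_ae φ] with t h1 h2 ht hn
    rw [← h2 hn, h1 ht]
  have hsub : Set.Icc 0 ℓ ⊆ Set.Icc (-ℓ) (2 * ℓ) := Set.Icc_subset_Icc (by linarith) (by linarith)
  have hderiv : deriv g =ᵐ[volume.restrict (Set.Icc 0 ℓ)] fun t => Complex.I * v t := by
    rw [EventuallyEq, ae_restrict_iff' measurableSet_Icc]
    filter_upwards [deriv_primitive_ae_eq hvi] with t ht htm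
    rw [hg, deriv_const_add, ht (by rw [Set.uIcc_of_le hab]; exact hsub htm)]
  refine ⟨g, ?_, ?_, ?_, ?_, ?_⟩
  · refine hac.mono ?_
    rw [Set.uIcc_of_le hab, Set.uIcc_of_le hℓ.le]
    exact hsub
  · exact (memLp_congr_ae hderiv).2 (((Lp.memLp v).const_mul Complex.I).restrict _)
  · rw [EventuallyEq, ae_restrict_iff' measurableSet_Icc]
    filter_upwards [hc, (ae_restrict_iff' measurableSet_Icc).1 (extendZero_ae_eq_restrict φ)]
      with t h1 h2 ht
    rw [← h2 ht, h1 (hsub ht)]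
  -- To the left of 0 the extension is zero, so g vanishes almost everywhere there, and continuity
  -- carries this to g 0. The right end point is treated in the same way on [ℓ, 2ℓ].
  · refine eqOn_zero_of_ae_eq_zero (neg_neg_of_pos hℓ)
      (hgc.mono (Set.Icc_subset_Icc le_rfl (by linarith))) ?_ ⟨by linarith, le_rfl⟩
    filter_upwards [hout] with t ht htm
    exact ht ⟨htm.1.le, by linarith [htm.2]⟩ fun h => by linarith [h.1, htm.2]
  · refine eqOn_zero_of_ae_eq_zero (a := ℓ) (b := 2 * ℓ) (by linarith)
      (hgc.mono (Set.Icc_subset_Icc (by linarith) le_rfl)) ?_ ⟨le_rfl, by linarith⟩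
    filter_upwards [hout] with t ht htm
    exact ht ⟨by linarith [htm.1], htm.2.le⟩ fun h => by linarith [h.2, htm.1]

end WeakMoment

/-! ### Vector integrals against P(·)φ compared with weak integrals and L² products -/

section VectorIntegral

variable {ℓ : ℝ}

/-- The density of the complex measure `⟪χ, P(·) φ⟫`. -/
noncomputable def momentumDensity (χ φ : L2I ℓ) (x : ℝ) : ℂ :=
  ⟪fourierPlancherel (extendZero ℓ χ) x, fourierPlancherel (extendZero ℓ φ) x⟫_ℂ

lemma stronglyMeasurable_momentumDensity (χ φ : L2I ℓ) :
    StronglyMeasurable (momentumDensity χ φ) :=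
  (Lp.stronglyMeasurable _).inner (Lp.stronglyMeasurable _)

lemma integrable_momentumDensity (χ φ : L2I ℓ) : Integrable (momentumDensity χ φ) :=
  L2.integrable_inner _ _

lemma momentum_op_apply {X : Set ℝ} (hX : MeasurableSet X) (φ : L2I ℓ) :
    (momentum ℓ).op X φ = ContinuousLinearMap.adjoint (extendZero ℓ).toContinuousLinearMap
      (ContinuousLinearMap.adjoint fourierPlancherel.toContinuousLinearMap
        (chiMul X hX (fourierPlancherel (extendZero ℓ φ)))) := by
  have h : positionR.op X = chiMul X hX := dif_pos hX
  rw [← h]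
  rfl

lemma inner_momentum_op {X : Set ℝ} (hX : MeasurableSet X) (χ φ : L2I ℓ) :
    ⟪χ, (momentum ℓ).op X φ⟫_ℂ = ∫ x in X, momentumDensity χ φ x := by
  rw [momentum_op_apply hX, ContinuousLinearMap.adjoint_inner_right,
    ContinuousLinearMap.adjoint_inner_right]
  exact inner_chiMul_right X hX _ _

lemma inner_momentum_vectorMeasure {X : Set ℝ} (hX : MeasurableSet X) (χ φ : L2I ℓ) :
    ⟪χ, (momentum ℓ).vectorMeasure φ X⟫_ℂ = ∫ x in X, momentumDensity χ φ x := by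
  have h : (momentum ℓ).vectorMeasure φ X = (momentum ℓ).op X φ := if_pos hX
  rw [h, inner_momentum_op hX]

lemma integrable_simpleFunc_mul (g : SimpleFunc ℝ ℂ) {m : ℝ → ℂ} (hm : Integrable m) :
    Integrable fun x => g x * m x := by
  obtain ⟨C, hC⟩ := g.exists_forall_norm_le
  exact hm.bdd_mul g.stronglyMeasurable.aestronglyMeasurable (ae_of_all _ hC)

lemma inner_simpleIntegral (g : SimpleFunc ℝ ℂ) {X : Set ℝ} (hX : MeasurableSet X)
    (χ φ : L2I ℓ) : ⟪χ, simpleIntegral ((momentum ℓ).vectorMeasure φ) g X⟫_ℂ =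
      ∫ x in X, g x * momentumDensity χ φ x := by
  set m := momentumDensity χ φ with hm
  have hmi : Integrable m := integrable_momentumDensity χ φ
  have h1 : ∀ x, g x * m x = ∑ y ∈ g.range, (g ⁻¹' {y}).indicator (fun x => y * m x) x := by
    intro x
    rw [Finset.sum_eq_single (g x)]
    · rw [Set.indicator_of_mem (by simp)]
    · intro y _ hy
      exact Set.indicator_of_notMem (fun h => hy h.symm) _
    · intro h
      exact absurd (g.mem_range_self x) h
  simp_rw [h1]
  rw [integral_finsetSum _ fun y _ =>
    ((hmi.const_mul y).indicator (g.measurableSet_fiber y)).restrict, simpleIntegral, inner_sum]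
  refine Finset.sum_congr rfl fun y _ => ?_
  rw [inner_smul_right, inner_momentum_vectorMeasure ((g.measurableSet_fiber y).inter hX),
    integral_indicator (g.measurableSet_fiber y), Measure.restrict_restrict (g.measurableSet_fiber y),
    integral_const_mul]

/-- Vector integrals with respect to `P(·) φ` are weak integrals. -/
lemma inner_eq_integral_of_hasVectorIntegral {f : ℝ → ℂ} {φ v : L2I ℓ}
    (h : HasVectorIntegral ((momentum ℓ).vectorMeasure φ) f v) (χ : L2I ℓ) :
    Integrable (fun x => f x * momentumDensity χ φ x) ∧
      ⟪χ, v⟫_ℂ = ∫ x, f x * momentumDensity χ φ x := by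
  obtain ⟨g, hg, hconv, hv⟩ := h
  set m := momentumDensity χ φ with hm
  have hmi : Integrable m := integrable_momentumDensity χ φ
  have hms : StronglyMeasurable m := stronglyMeasurable_momentumDensity χ φ
  have hρ : Measurable fun x => ‖m x‖₊ := hms.measurable.nnnorm
  -- Polar decomposition of the complex measure: m = |m| p, with p = 0 where m = 0. Since |m| is
  -- integrable, `lam` is finite, and the convergence theorem applies to the functions g k · p.
  set lam : Measure ℝ := volume.withDensity fun x => (‖m x‖₊ : ℝ≥0∞) with hlam
  have : IsFiniteMeasure lam := isFiniteMeasure_withDensity hmi.2.ne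
  set p : ℝ → ℂ := fun x => m x / ‖m x‖ with hp
  have hps : StronglyMeasurable p :=
    (hms.measurable.div (Complex.measurable_ofReal.comp hms.measurable.norm)).stronglyMeasurable
  have hpm : ∀ (c : ℂ) x, ‖m x‖₊ • (c * p x) = c * m x := by
    intro c x
    rw [NNReal.smul_def, coe_nnnorm, Complex.real_smul]
    by_cases h0 : m x = 0
    · simp [hp, h0]
    · have : (‖m x‖ : ℂ) ≠ 0 := by exact_mod_cast norm_ne_zero_iff.2 h0
      simp only [hp]
      field_simp
  have hint : ∀ k, Integrable (fun x => g k x * p x) lam := fun k => by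
    rw [hlam, integrable_withDensity_iff_integrable_smul hρ]
    simp_rw [hpm]
    exact integrable_simpleFunc_mul (g k) hmi
  have hset : ∀ k X, MeasurableSet X → ∫ x in X, g k x * p x ∂lam = ∫ x in X, g k x * m x := by
    intro k X hX
    rw [hlam, restrict_withDensity hX, integral_withDensity_eq_integral_smul hρ]
    simp_rw [hpm]
  have hmain := integrable_and_tendsto_integral_of_setIntegral_tendsto (μ := lam)
    (h := fun k x => g k x * p x) (f := fun x => f x * p x) hint
    (fun k => (g k).stronglyMeasurable.mul hps) (fun x => (hg x).mul_const _) fun X hX => by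
      obtain ⟨w, hw⟩ := hconv X hX
      refine ⟨⟪χ, w⟫_ℂ, ?_⟩
      have h1 := (tendsto_const_nhds (x := χ)).inner (𝕜 := ℂ) hw
      simp_rw [inner_simpleIntegral _ hX] at h1
      simp_rw [hset _ X hX]
      exact h1
  constructor
  · have h1 := hmain.1
    rw [hlam, integrable_withDensity_iff_integrable_smul hρ] at h1
    simpa only [hpm] using h1
  · have h1 := (tendsto_const_nhds (x := χ)).inner (𝕜 := ℂ) hv
    simp_rw [inner_simpleIntegral _ MeasurableSet.univ] at h1
    have h2 := hmain.2
    rw [hlam, integral_withDensity_eq_integral_smul hρ] at h2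
    simp_rw [hpm] at h2
    refine tendsto_nhds_unique h1 (h2.congr fun k => ?_)
    rw [← hset k _ MeasurableSet.univ, Measure.restrict_univ]

lemma weaklyIntegrable_of_moment {n : ℕ} {φ v : L2I ℓ} (h : (φ, v) ∈ (momentum ℓ).moment n) :
    WeaklyIntegrable ℓ n φ := fun χ => by
  refine (inner_eq_integral_of_hasVectorIntegral h χ).1.congr (ae_of_all _ fun x => ?_)
  simp only [momentumDensity]
  rw [← smul_eq_mul, ← smul_eq_mul, inner_smul_right, smul_eq_mul]

/-- The strong operator integral is single valued. -/
lemma hasVectorIntegral_unique {f : ℝ → ℂ} {φ v w : L2I ℓ}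
    (hv : HasVectorIntegral ((momentum ℓ).vectorMeasure φ) f v)
    (hw : HasVectorIntegral ((momentum ℓ).vectorMeasure φ) f w) : v = w :=
  ext_inner_left ℂ fun χ => by
    rw [(inner_eq_integral_of_hasVectorIntegral hv χ).2,
      (inner_eq_integral_of_hasVectorIntegral hw χ).2]

/-- Dominated convergence in L², with the majorant bounding the distance to the limit, the form that
simple function approximation delivers. -/
lemma tendsto_toLp_of_dominated {u : ℕ → ℝ → ℂ} {u₀ b : ℝ → ℂ} (hu : ∀ k, MemLp (u k) 2 volume)
    (hu₀ : MemLp u₀ 2 volume) (hb : MemLp b 2 volume) (hle : ∀ k x, ‖u k x - u₀ x‖ ≤ ‖b x‖)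
    (hlim : ∀ x, Tendsto (fun k => u k x) atTop (𝓝 (u₀ x))) :
    Tendsto (fun k => (hu k).toLp (u k)) atTop (𝓝 (hu₀.toLp u₀)) := by
  rw [Lp.tendsto_Lp_iff_tendsto_eLpNorm'']
  have h1 : Tendsto (fun k => ∫⁻ x, ‖(u k - u₀) x‖ₑ ^ (2 : ℝ≥0∞).toReal) atTop
      (𝓝 (∫⁻ _ : ℝ, 0)) := by
    refine tendsto_lintegral_of_dominated_convergence' (fun x => ‖b x‖ₑ ^ (2 : ℝ≥0∞).toReal)
      (fun k => ((hu k).1.sub hu₀.1).enorm.pow_const _) (fun k => ae_of_all _ fun x => ?_) ?_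
      (ae_of_all _ fun x => ?_)
    · exact ENNReal.rpow_le_rpow (enorm_le_iff_norm_le.2 (hle k x)) (by simp)
    · exact (lintegral_rpow_enorm_lt_top_of_eLpNorm_lt_top (by simp) (by simp) hb.2).ne
    · have h2 : Tendsto (fun k => ‖(u k - u₀) x‖ₑ) atTop (𝓝 0) := by
        have h3 := (((hlim x).sub_const (u₀ x)).enorm)
        simpa using h3
      have h4 := (ENNReal.continuous_rpow_const (y := (2 : ℝ≥0∞).toReal)).tendsto 0 |>.comp h2
      simpa [Function.comp_def] using h4
  have h5 := (ENNReal.continuous_rpow_const (y := 1 / (2 : ℝ≥0∞).toReal)).tendsto _ |>.comp h1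
  simp_rw [eLpNorm_eq_lintegral_rpow_enorm_toReal (p := 2) (μ := volume) (by simp) (by simp)]
  simpa [Function.comp_def] using h5

lemma memLp_simpleFunc_mul (g : SimpleFunc ℝ ℂ) (ψ : L2R) : MemLp (fun x => g x * ψ x) 2 volume := by
  obtain ⟨C, hC⟩ := g.exists_forall_norm_le
  refine (Lp.memLp ψ).of_le_mul (c := C) (g.stronglyMeasurable.aestronglyMeasurable.mul
    (Lp.aestronglyMeasurable ψ)) (ae_of_all _ fun x => ?_)
  rw [norm_mul]
  gcongr
  exact hC x

/-- If `f ψ` is square integrable, where `ψ` is the transform of `φ`, then `f` is integrable with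
respect to `P(·) φ`. -/
lemma hasVectorIntegral_of_memLp {f : ℝ → ℂ} (hf : Measurable f) {φ w : L2I ℓ}
    (hw : fourierPlancherel (extendZero ℓ w) =ᵐ[volume]
      fun x => f x * fourierPlancherel (extendZero ℓ φ) x) :
    HasVectorIntegral ((momentum ℓ).vectorMeasure φ) f w := by
  set ψ := fourierPlancherel (extendZero ℓ φ) with hψ
  have hfψ : MemLp (fun x => f x * ψ x) 2 volume :=
    (memLp_congr_ae hw).1 (Lp.memLp (fourierPlancherel (extendZero ℓ w)))
  -- With base point 0 the approximations satisfy |g k - f| ≤ |f|, so |f ψ| serves as majorant.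
  let g : ℕ → SimpleFunc ℝ ℂ := SimpleFunc.approxOn f hf Set.univ 0 (Set.mem_univ _)
  have hg : ∀ x, Tendsto (fun k => g k x) atTop (𝓝 (f x)) := fun x =>
    SimpleFunc.tendsto_approxOn hf _ (by simp)
  have hgle : ∀ k x, ‖g k x - f x‖ ≤ ‖f x‖ := fun k x => by
    have h := SimpleFunc.edist_approxOn_le hf (Set.mem_univ (0 : ℂ)) x k
    rw [edist_dist, edist_dist, ENNReal.ofReal_le_ofReal_iff dist_nonneg, dist_eq_norm,
      dist_zero_left] at h
    exact h
  -- T = U*F* is bounded and sends the restriction of g k · ψ to X to the simple integral over X, so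
  -- L² convergence passes to the vector integrals.
  let T := (ContinuousLinearMap.adjoint (extendZero ℓ).toContinuousLinearMap) ∘L
    (ContinuousLinearMap.adjoint fourierPlancherel.toContinuousLinearMap)
  have hT : ∀ (χ : L2I ℓ) (η : L2R), ⟪χ, T η⟫_ℂ = ⟪fourierPlancherel (extendZero ℓ χ), η⟫_ℂ := by
    intro χ η
    simp only [T, ContinuousLinearMap.comp_apply, ContinuousLinearMap.adjoint_inner_right]
    rfl
  have key : ∀ k X (hX : MeasurableSet X),
      simpleIntegral ((momentum ℓ).vectorMeasure φ) (g k) X =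
        T (((memLp_simpleFunc_mul (g k) ψ).indicator hX).toLp _) := by
    intro k X hX
    refine ext_inner_left ℂ fun χ => ?_
    rw [inner_simpleIntegral _ hX, hT, L2.inner_def, ← integral_indicator hX]
    apply integral_congr_ae
    filter_upwards [((memLp_simpleFunc_mul (g k) ψ).indicator hX).coeFn_toLp] with x hx
    rw [hx]
    by_cases hm : x ∈ X
    · rw [Set.indicator_of_mem hm, Set.indicator_of_mem hm, ← smul_eq_mul, ← smul_eq_mul,
        inner_smul_right]
      rfl
    · rw [Set.indicator_of_notMem hm, Set.indicator_of_notMem hm, inner_zero_right]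
  have hlim : ∀ X, MeasurableSet X → ∀ h : MemLp (X.indicator fun x => f x * ψ x) 2 volume,
      Tendsto (fun k => simpleIntegral ((momentum ℓ).vectorMeasure φ) (g k) X) atTop
        (𝓝 (T (h.toLp _))) := by
    intro X hX h
    simp_rw [key _ X hX]
    refine (T.continuous.tendsto _).comp (tendsto_toLp_of_dominated _ h hfψ ?_ ?_)
    · intro k x
      by_cases hm : x ∈ X
      · rw [Set.indicator_of_mem hm, Set.indicator_of_mem hm, ← sub_mul, norm_mul, norm_mul]
        gcongr
        exact hgle k x
      · rw [Set.indicator_of_notMem hm, Set.indicator_of_notMem hm, sub_zero, norm_zero]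
        positivity
    · intro x
      by_cases hm : x ∈ X
      · simp only [Set.indicator_of_mem hm]
        exact (hg x).mul_const _
      · simp only [Set.indicator_of_notMem hm]
        exact tendsto_const_nhds
  refine ⟨g, hg, fun X hX => ⟨_, hlim X hX (hfψ.indicator hX)⟩, ?_⟩
  have h1 := hlim Set.univ MeasurableSet.univ (hfψ.indicator MeasurableSet.univ)
  -- The function f ψ is F U w, and T is a left inverse of the isometry F U.
  have h2 : T ((hfψ.indicator MeasurableSet.univ).toLp _) = w := by
    refine ext_inner_left ℂ fun χ => ?_
    have h3 : (hfψ.indicator MeasurableSet.univ).toLp _ = fourierPlancherel (extendZero ℓ w) := by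
      apply Lp.ext
      filter_upwards [(hfψ.indicator MeasurableSet.univ).coeFn_toLp, hw] with x a1 a2
      rw [a1, a2, Set.indicator_univ]
    rw [h3, hT, LinearIsometry.inner_map_map, LinearIsometry.inner_map_map]
  rwa [h2] at h1

lemma diagMeasure_momentum_apply (φ : L2I ℓ) {X : Set ℝ} (hX : MeasurableSet X) :
    (momentum ℓ).diagMeasure φ X = ∫⁻ x in X, ‖fourierPlancherel (extendZero ℓ φ) x‖ₑ ^ 2 := by
  set ψ := fourierPlancherel (extendZero ℓ φ) with hψ
  have h1 : (momentum ℓ).diagMeasure φ X =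
      ENNReal.ofReal (RCLike.re ⟪φ, (momentum ℓ).op X φ⟫_ℂ) := Measure.ofMeasurable_apply X hX
  have h2 : ∀ x, momentumDensity φ φ x = ((‖ψ x‖ ^ 2 : ℝ) : ℂ) := fun x => by
    rw [momentumDensity, inner_self_eq_norm_sq_to_K]; simp [hψ]
  have hint : Integrable (fun x => ‖ψ x‖ ^ 2) volume :=
    (memLp_two_iff_integrable_sq_norm (Lp.aestronglyMeasurable ψ)).1 (Lp.memLp ψ)
  rw [h1, inner_momentum_op hX]
  simp_rw [h2]
  rw [integral_complex_ofReal, RCLike.re_to_complex, Complex.ofReal_re,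
    ofReal_integral_eq_lintegral_ofReal hint.restrict (ae_of_all _ fun x => by positivity)]
  refine lintegral_congr fun x => ?_
  rw [ENNReal.ofReal_pow (norm_nonneg _), ofReal_norm]

lemma diagMeasure_momentum (φ : L2I ℓ) : (momentum ℓ).diagMeasure φ =
    volume.withDensity fun x => ‖fourierPlancherel (extendZero ℓ φ) x‖ₑ ^ 2 := by
  ext X hX
  rw [diagMeasure_momentum_apply φ hX, withDensity_apply _ hX]

lemma mem_sqDomain_of_memLp {f : ℝ → ℂ} {φ : L2I ℓ}
    (h : MemLp (fun x => f x * fourierPlancherel (extendZero ℓ φ) x) 2 volume) :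
    φ ∈ (momentum ℓ).sqDomain f := by
  have hm : Measurable fun x => ‖fourierPlancherel (extendZero ℓ φ) x‖ₑ ^ 2 :=
    (Lp.stronglyMeasurable _).measurable.enorm.pow_const 2
  change Integrable (fun x => ‖f x‖ ^ 2) ((momentum ℓ).diagMeasure φ)
  rw [diagMeasure_momentum, integrable_withDensity_iff_integrable_smul' hm
    (ae_of_all _ fun x => by simp)]
  refine ((memLp_two_iff_integrable_sq_norm h.1).1 h).congr (ae_of_all _ fun x => ?_)
  simp [mul_pow, mul_comm]

end VectorIntegral

/-! ### Powers of the operator and the cycle of inclusions -/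

section Powers

/-- In terms of graphs the product is composition of relations, which frees the inductions from
nested domain subtypes. -/
lemma mem_graph_opMul {H : Type*} [AddCommGroup H] [Module ℂ H] {A B : H →ₗ.[ℂ] H} {x y : H} :
    (x, y) ∈ (opMul A B).graph ↔ ∃ z, (x, z) ∈ B.graph ∧ (z, y) ∈ A.graph := by
  simp only [LinearPMap.mem_graph_iff]
  constructor
  · rintro ⟨⟨_, ⟨⟨x, hx⟩, hz, rfl⟩, hx'⟩, rfl, rfl⟩
    exact ⟨B ⟨x, hx⟩, ⟨⟨x, hx⟩, rfl, rfl⟩, ⟨⟨B ⟨x, hx⟩, hz⟩, rfl, rfl⟩⟩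
  · rintro ⟨z, ⟨⟨x, hx⟩, rfl, rfl⟩, ⟨⟨z, hz⟩, hz', rfl⟩⟩
    obtain rfl : z = B ⟨x, hx⟩ := hz'
    exact ⟨⟨x, ⟨⟨x, hx⟩, hz, rfl⟩, hx⟩, rfl, rfl⟩

variable {ℓ : ℝ}

/-- The Fourier-Plancherel transform turns `n`-th powers into multiplication by `xⁿ`. -/
lemma fourierPlancherel_opPow (hℓ : 0 < ℓ) (n : ℕ) {φ w : L2I ℓ}
    (h : (φ, w) ∈ (opPow (dirichletMomentum ℓ) n).graph) :
    fourierPlancherel (extendZero ℓ w) =ᵐ[volume]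
      fun x : ℝ => (x : ℂ) ^ n * fourierPlancherel (extendZero ℓ φ) x := by
  induction n generalizing w with
  | zero =>
    obtain ⟨y, hy1, hy2⟩ := LinearPMap.mem_graph_iff _ |>.1 h
    have hw : w = φ := hy2.symm.trans hy1
    rw [hw]
    exact ae_of_all _ fun x => by simp
  | succ n ih =>
    obtain ⟨z, hz, hzw⟩ := mem_graph_opMul.1 h
    obtain ⟨y, rfl, rfl⟩ := LinearPMap.mem_graph_iff _ |>.1 hzw
    filter_upwards [ih hz, fourierPlancherel_dirichletMomentum hℓ y] with x h1 h2
    rw [h2, h1]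
    ring

/-- The densities themselves are integrable, and |x|ⁿ ≤ 1 + |x|ⁿ⁺¹. -/
lemma WeaklyIntegrable.of_succ {n : ℕ} {φ : L2I ℓ} (h : WeaklyIntegrable ℓ (n + 1) φ) :
    WeaklyIntegrable ℓ n φ := fun χ => by
  refine ((integrable_momentumDensity χ φ).norm.add (h χ).norm).mono'
    ((Lp.aestronglyMeasurable _).inner (aestronglyMeasurable_pow_mul n _)) (ae_of_all _ fun x => ?_)
  simp only [momentumDensity, Pi.add_apply, RCLike.inner_apply, norm_mul, RCLike.norm_conj, norm_pow,
    Complex.norm_real]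
  set r := ‖x‖ with hr
  have hr0 : 0 ≤ r := norm_nonneg _
  set c := ‖fourierPlancherel (extendZero ℓ χ) x‖
  set d := ‖fourierPlancherel (extendZero ℓ φ) x‖
  have h1 : r ^ n ≤ 1 + r ^ (n + 1) := by
    rcases le_total r 1 with h | h
    · have := pow_le_one₀ (n := n) hr0 h
      have := pow_nonneg hr0 (n + 1)
      linarith
    · have : r ^ n ≤ r ^ (n + 1) := pow_le_pow_right₀ h (Nat.le_succ n)
      linarith
  calc r ^ n * d * c ≤ (1 + r ^ (n + 1)) * d * c := by gcongr
    _ = d * c + r ^ (n + 1) * d * c := by ring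

/-- If `xⁿ` is weakly integrable, then `φ` is in the domain of the `n`-th power. -/
lemma WeaklyIntegrable.exists_mem_graph (hℓ : 0 < ℓ) (n : ℕ) {φ : L2I ℓ}
    (h : WeaklyIntegrable ℓ n φ) : ∃ w, (φ, w) ∈ (opPow (dirichletMomentum ℓ) n).graph := by
  induction n with
  | zero => exact ⟨φ, LinearPMap.mem_graph_iff _ |>.2 ⟨⟨φ, Submodule.mem_top⟩, rfl, rfl⟩⟩
  | succ n ih =>
    obtain ⟨z, hz⟩ := ih h.of_succ
    -- The transform of z is xⁿ times that of φ, so one further factor x on z is the factor xⁿ⁺¹ on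
    -- φ.
    have hz1 : WeaklyIntegrable ℓ 1 z := fun χ => by
      refine (h χ).congr ?_
      filter_upwards [fourierPlancherel_opPow hℓ n hz] with x hx
      rw [hx, pow_succ', pow_one, mul_assoc]
    exact ⟨_, mem_graph_opMul.2 ⟨z, hz, LinearPMap.mem_graph _ ⟨z, hz1.mem_domain hℓ⟩⟩⟩

lemma graph_opPow_subset_sqMoment (hℓ : 0 < ℓ) (n : ℕ) :
    ((opPow (dirichletMomentum ℓ) n).graph : Set (L2I ℓ × L2I ℓ)) ⊆ (momentum ℓ).sqMoment n := by
  rintro ⟨φ, w⟩ h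
  have hF := fourierPlancherel_opPow hℓ n h
  exact ⟨mem_sqDomain_of_memLp ((memLp_congr_ae hF).1 (Lp.memLp _)),
    hasVectorIntegral_of_memLp (Complex.measurable_ofReal.pow_const n) hF⟩

lemma sqMoment_subset_moment (n : ℕ) : (momentum ℓ).sqMoment n ⊆ (momentum ℓ).moment n :=
  fun _ h => h.2

/-- Weak integrability only places φ in the domain. The value is identified afterwards: P₀ⁿφ is also
a vector integral, and such integrals are unique. -/
lemma moment_subset_graph_opPow (hℓ : 0 < ℓ) (n : ℕ) :
    (momentum ℓ).moment n ⊆ ((opPow (dirichletMomentum ℓ) n).graph : Set (L2I ℓ × L2I ℓ)) := by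
  rintro ⟨φ, v⟩ h
  obtain ⟨w, hw⟩ := (weaklyIntegrable_of_moment h).exists_mem_graph hℓ n
  have hvw : v = w :=
    hasVectorIntegral_unique h (sqMoment_subset_moment n (graph_opPow_subset_sqMoment hℓ n hw))
  rw [hvw]
  exact hw

end Powers

end MomentumMoments

theorem mainTheorem2 (ℓ : ℝ) (hℓ : 0 < ℓ) (n : ℕ) (hn : 1 ≤ n) :
    (MomentumMoments.momentum ℓ).moment n = (MomentumMoments.momentum ℓ).sqMoment n ∧
    (MomentumMoments.momentum ℓ).sqMoment n =
      ((MomentumMoments.opPow (MomentumMoments.dirichletMomentum ℓ) n).graph :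
        Set (MomentumMoments.L2I ℓ × MomentumMoments.L2I ℓ)) :=
  ⟨((MomentumMoments.moment_subset_graph_opPow hℓ n).trans
      (MomentumMoments.graph_opPow_subset_sqMoment hℓ n)).antisymm
      (MomentumMoments.sqMoment_subset_moment n),
    ((MomentumMoments.sqMoment_subset_moment n).trans
      (MomentumMoments.moment_subset_graph_opPow hℓ n)).antisymm
      (MomentumMoments.graph_opPow_subset_sqMoment hℓ n)⟩
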